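/- For integers $n\ge 0$ put $b_n=4^n\binom{2n}{n}^{-1}$. For compositions (finite, possibly empty, sequences of positive integers) $\mathbf k=(k_1,\dots,k_d)$ and $\mathbf l=(l_1,\dots,l_e)$ put $$\zeta_n(\mathbf k)=\sum_{n\ge m_1>\cdots>m_d>0}\frac{1}{m_1^{k_1}\cdots m_d^{k_d}},\qquad t_n(\mathbf l)=\sum_{n\ge r_1>\cdots>r_e>0}\frac{1}{(2r_1-1)^{l_1}\cdots(2r_e-1)^{l_e}},$$ with $\zeta_n(\emptyset)=t_n(\emptyset)=1$, and $|\mathbf k|=k_1+\cdots+k_d$, $|\mathbf l|=l_1+\cdots+l_e$. For $w\ge 1$ let $\mathsf{CMZV}^4_w\subset\mathbb C$ be the $\mathbb Q$-linear span of all colored multiple zeta values of level $4$ and weight $w$, that is, of all numbers $$\mathrm{Li}_{\mathbf s}(\mathbf z)=\sum_{n_1>\cdots>n_r>0}\frac{z_1^{n_1}\cdots z_r^{n_r}}{n_1^{s_1}\cdots n_r^{s_r}}=\lim_{M\to\infty}\ \sum_{M\ge n_1>\cdots>n_r>0}\frac{z_1^{n_1}\cdots z_r^{n_r}}{n_1^{s_1}\cdots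 n_r^{s_r}}$$ with $r\ge1$, positive integers $s_1,\dots,s_r$ such that $s_1+\cdots+s_r=w$, and complex numbers $z_1,\dots,z_r$ with $z_j^4=1$ and $(s_1,z_1)\ne(1,1)$. Then for all integers $p\ge 2$ and $q\ge 3$ and all compositions $\mathbf k,\mathbf l$ (possibly empty), the following four series converge and \begin{align*} \text{(a)}&\quad \sum_{n=1}^\infty b_n\frac{\zeta_n(\mathbf k)\,t_n(\mathbf l)}{n^{p}}\in \mathsf{CMZV}^4_{|\mathbf k|+|\mathbf l|+p},\\ \text{(b)}&\quad \sum_{n=1}^\infty b_n^2\,\frac{\zeta_n(\mathbf k)\,t_n(\mathbf l)}{n^{q}}\in \mathsf{CMZV}^4_{|\mathbf k|+|\mathbf l|+q},\\ \text{(c)}&\quad \sum_{n=0}^\infty b_n\frac{\zeta_n(\mathbf k)\,t_n(\mathbf l)}{(2n+1)^{p}}\in i\,\mathsf{CMZV}^4_{|\mathbf k|+|\mathbf l|+p},\\ \text{(d)}&\quad \sum_{n=0}^\infty b_n^2\,\frac{\zeta_n(\mathbf k)\,t_n(\mathbf l)}{(2n+1)^{q}}\in \mathsf{CMZV}^4_{|\mathbf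 k|+|\mathbf l|+q}. \end{align*} -/

import Mathlib

/-- `b_n = 4 ^ n / binom (2n) n`. -/
noncomputable def aperyB (n : ℕ) : ℝ := 4 ^ n / (Nat.centralBinom n : ℝ)

/-- The truncated multiple zeta value
`ζ_n(k_1, …, k_d) = ∑_{n ≥ m_1 > ⋯ > m_d > 0} 1 / (m_1 ^ k_1 ⋯ m_d ^ k_d)`,
by recursion on the depth (outermost index `m_1` first); `ζ_n(∅) = 1`. -/
noncomputable def zetaTrunc : List ℕ → ℕ → ℝ
  | [], _ => 1
  | k :: ks, n => ∑ m ∈ Finset.Icc 1 n, 1 / (m : ℝ) ^ k * zetaTrunc ks (m - 1)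

/-- The truncated multiple `t`-value
`t_n(l_1, …, l_e) = ∑_{n ≥ r_1 > ⋯ > r_e > 0} 1 / ((2 r_1 - 1) ^ l_1 ⋯ (2 r_e - 1) ^ l_e)`;
`t_n(∅) = 1`. -/
noncomputable def tTrunc : List ℕ → ℕ → ℝ
  | [], _ => 1
  | l :: ls, n => ∑ r ∈ Finset.Icc 1 n, 1 / (2 * (r : ℝ) - 1) ^ l * tTrunc ls (r - 1)

/-- The truncated multiple polylogarithm
`∑_{M ≥ n_1 > ⋯ > n_d > 0} z_1 ^ n_1 ⋯ z_d ^ n_d / (n_1 ^ s_1 ⋯ n_d ^ s_d)`;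
the index is the list of pairs `(s_j, z_j)`. -/
noncomputable def liTrunc : List (ℕ × ℂ) → ℕ → ℂ
  | [], _ => 1
  | a :: as, M => ∑ n ∈ Finset.Icc 1 M, a.2 ^ n / (n : ℂ) ^ a.1 * liTrunc as (n - 1)

/-- `v` is a colored multiple zeta value `Li_s(z)` of level `N` and weight `w`: the `s_j` are
positive integers with sum `w`, the `z_j` are `N`-th roots of unity, `(s_1, z_1) ≠ (1, 1)`, and
the defining series, in general only conditionally convergent, is summed with respect to the
largest index `n_1`. -/
def IsCMZV (N w : ℕ) (v : ℂ) : Prop :=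
  ∃ a : List (ℕ × ℂ),
    (∀ x ∈ a, 0 < x.1 ∧ x.2 ^ N = 1) ∧
    a.head? ≠ some (1, 1) ∧
    (a.map Prod.fst).sum = w ∧
    Filter.Tendsto (liTrunc a) Filter.atTop (nhds v)

/-- The `ℚ`-linear span in `ℂ` of the colored multiple zeta values of level `N` and weight `w`. -/
noncomputable def CMZV (N w : ℕ) : Submodule ℚ ℂ := Submodule.span ℚ {v | IsCMZV N w v}

/-! Form generating series in `sin t` and put `u = tan (t / 2)`, so that `t = π / 2` becomes `u =
1`. Then `cot t dt`, `tan t dt`, `dt / sin t`, `dt / (sin t cos t)` and `i dt` are rational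
combinations of `du / u` and `ξ du / (1 - ξ u)` with `ξ ^ 4 = 1`. Iterated integrals of these forms
are level four polylogarithms in `u`, each integration raising the weight by one, and their values
at `u = 1` are colored multiple zeta values.

The engine is `primSeries_hasDerivAt`: if `C_n = ∑_{m < n} c_m`, then `cos t ∑ b_n C_{n+1}
sin^{2n+1} t / (2n+1)` has `t`-derivative `∑ b_n c_n sin^{2n} t`, because `(2n+1) b_{n+1} = (2n+2)
b_n` makes the derivative telescope. One integration thus absorbs one summation sign; further powers
of `2n` or `2n+1` in the denominator are integrations against `cot t dt`. `Good.even_step` and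
`Good.odd_step` prepend a summation over an even or an odd index.

The indices `2m` of `ζ_n` and `2r - 1` of `t_n` never coincide, so `ζ_n(k) t_n(l)` is peeled off by
its largest index (`good_ztPred_and_oddGood_zt`).

With outer exponent at least 2 the last form has no pole at `u = 1`, so only convergent
polylogarithms occur and Abel's theorem gives the value. Since `∫ sin^{2n+1} t dt` over `[0, π/2]`
equals `b_n / (2n+1)`, the series with `b_n ^ 2` need one more integration (`hasSum_mul_sinInt`).
The factor `i` in (c) comes from `i dt`; in (d) the extra `dt` cancels it. -/

namespace AperySeries
open Filter Topology Finset

/-! ### Power series with coefficients of polynomial growth. -/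

/-- A sequence of complex numbers bounded by a polynomial in the index. -/
def PolyGrowth (a : ℕ → ℂ) : Prop := ∃ (K : ℝ) (j : ℕ), 0 ≤ K ∧ ∀ n, ‖a n‖ ≤ K * ((n : ℝ) + 1) ^ j

namespace PolyGrowth

variable {a b : ℕ → ℂ}

theorem of_le (ha : PolyGrowth a) (h : ∀ n, ‖b n‖ ≤ ‖a n‖) : PolyGrowth b := by
  obtain ⟨K, j, hK, hj⟩ := ha
  exact ⟨K, j, hK, fun n => (h n).trans (hj n)⟩

theorem of_bounded (K : ℝ) (h : ∀ n, ‖a n‖ ≤ K) : PolyGrowth a :=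
  ⟨K, 0, (norm_nonneg _).trans (h 0), fun n => by simpa using h n⟩

theorem const (c : ℂ) : PolyGrowth fun _ => c := of_bounded ‖c‖ fun _ => le_rfl

theorem natCast_add_one : PolyGrowth fun n => (n : ℂ) + 1 :=
  ⟨1, 1, zero_le_one, fun n => by
    have : ‖(n : ℂ) + 1‖ = (n : ℝ) + 1 := by
      have := Complex.norm_natCast (n + 1)
      push_cast at this
      exact this
    rw [this]; simp⟩

theorem mul (ha : PolyGrowth a) (hb : PolyGrowth b) : PolyGrowth fun n => a n * b n := by
  obtain ⟨K, j, hK, hj⟩ := ha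
  obtain ⟨K', j', hK', hj'⟩ := hb
  refine ⟨K * K', j + j', by positivity, fun n => ?_⟩
  rw [norm_mul, pow_add]
  calc ‖a n‖ * ‖b n‖ ≤ (K * ((n : ℝ) + 1) ^ j) * (K' * ((n : ℝ) + 1) ^ j') :=
        mul_le_mul (hj n) (hj' n) (norm_nonneg _) (by positivity)
    _ = _ := by ring

theorem add (ha : PolyGrowth a) (hb : PolyGrowth b) : PolyGrowth fun n => a n + b n := by
  obtain ⟨K, j, hK, hj⟩ := ha
  obtain ⟨K', j', hK', hj'⟩ := hb
  refine ⟨K + K', j + j', by positivity, fun n => ?_⟩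
  have h1 : (1 : ℝ) ≤ (n : ℝ) + 1 := by simp
  calc ‖a n + b n‖ ≤ ‖a n‖ + ‖b n‖ := norm_add_le _ _
    _ ≤ K * ((n : ℝ) + 1) ^ j + K' * ((n : ℝ) + 1) ^ j' := add_le_add (hj n) (hj' n)
    _ ≤ K * ((n : ℝ) + 1) ^ (j + j') + K' * ((n : ℝ) + 1) ^ (j + j') := by
        gcongr <;> first | exact h1 | omega
    _ = _ := by ring

theorem const_mul (c : ℂ) (ha : PolyGrowth a) : PolyGrowth fun n => c * a n := (const c).mul ha

theorem sub (ha : PolyGrowth a) (hb : PolyGrowth b) : PolyGrowth fun n => a n - b n := by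
  simpa [sub_eq_add_neg] using ha.add (hb.const_mul (-1))

theorem shift (ha : PolyGrowth a) : PolyGrowth fun n => a (n + 1) := by
  obtain ⟨K, j, hK, hj⟩ := ha
  refine ⟨K * 2 ^ j, j, by positivity, fun n => (hj _).trans ?_⟩
  rw [mul_assoc, ← mul_pow]
  push_cast
  gcongr
  linarith [(Nat.cast_nonneg n : (0 : ℝ) ≤ n)]

theorem pred (ha : PolyGrowth a) : PolyGrowth fun n => a (n - 1) := by
  obtain ⟨K, j, hK, hj⟩ := ha
  refine ⟨K, j, hK, fun n => (hj _).trans ?_⟩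
  gcongr
  omega

theorem sum_range (ha : PolyGrowth a) : PolyGrowth fun n => ∑ m ∈ range n, a m := by
  obtain ⟨K, j, hK, hj⟩ := ha
  refine ⟨K, j + 1, hK, fun n => (norm_sum_le _ _).trans ?_⟩
  calc ∑ m ∈ range n, ‖a m‖ ≤ ∑ m ∈ range n, K * ((n : ℝ) + 1) ^ j := by
        refine sum_le_sum fun m hm => (hj m).trans ?_
        have : m < n := mem_range.1 hm
        gcongr
    _ = n * (K * ((n : ℝ) + 1) ^ j) := by simp
    _ ≤ ((n : ℝ) + 1) * (K * ((n : ℝ) + 1) ^ j) := by gcongr; linarith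
    _ = _ := by ring

theorem div_pow (ha : PolyGrowth a) {d : ℕ → ℕ} (s : ℕ) :
    PolyGrowth fun n => a n / (d n : ℂ) ^ s := by
  refine ha.of_le fun n => ?_
  rw [norm_div, norm_pow, Complex.norm_natCast]
  rcases Nat.eq_zero_or_pos (d n) with h | h
  · rcases Nat.eq_zero_or_pos s with h' | h'
    · simp [h']
    · simp [h, h'.ne']
  · exact div_le_self (norm_nonneg _) (one_le_pow₀ (by exact_mod_cast h))

theorem summable_norm (ha : PolyGrowth a) {z : ℂ} (hz : ‖z‖ < 1) :
    Summable fun n => ‖a n * z ^ n‖ := by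
  obtain ⟨K, j, hK, hj⟩ := ha
  have hs : Summable fun n : ℕ => K * 2 ^ j * (‖z‖ ^ n + (n : ℝ) ^ j * ‖z‖ ^ n) :=
    ((summable_geometric_of_lt_one (norm_nonneg _) hz).add
      (summable_pow_mul_geometric_of_norm_lt_one j (r := ‖z‖) (by simpa using hz))).mul_left _
  refine Summable.of_nonneg_of_le (fun _ => norm_nonneg _) (fun n => ?_) hs
  rw [norm_mul, norm_pow, ← one_add_mul, ← mul_assoc]
  gcongr
  refine (hj n).trans ?_
  rw [mul_assoc]
  gcongr
  rcases Nat.eq_zero_or_pos n with rfl | hn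
  · have : (1 : ℝ) ≤ 2 ^ j := one_le_pow₀ (by norm_num)
    have h0 : (0 : ℝ) ≤ 0 ^ j := by positivity
    simp only [Nat.cast_zero, zero_add, one_pow]
    nlinarith
  · have : (1 : ℝ) ≤ n := by exact_mod_cast hn
    calc ((n : ℝ) + 1) ^ j ≤ (2 * n) ^ j := by gcongr; linarith
      _ = 2 ^ j * (n : ℝ) ^ j := mul_pow _ _ _
      _ ≤ 2 ^ j * (1 + (n : ℝ) ^ j) := by gcongr; linarith

theorem summable (ha : PolyGrowth a) {z : ℂ} (hz : ‖z‖ < 1) : Summable fun n => a n * z ^ n :=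
  (ha.summable_norm hz).of_norm

end PolyGrowth

/-- The sum of the power series with coefficients `a`. -/
noncomputable def ps (a : ℕ → ℂ) (z : ℂ) : ℂ := ∑' n, a n * z ^ n

theorem ps_hasSum {a : ℕ → ℂ} (ha : PolyGrowth a) {z : ℂ} (hz : ‖z‖ < 1) :
    HasSum (fun n => a n * z ^ n) (ps a z) := (ha.summable hz).hasSum

theorem ps_add {a b : ℕ → ℂ} (ha : PolyGrowth a) (hb : PolyGrowth b) {z : ℂ} (hz : ‖z‖ < 1) :
    ps (fun n => a n + b n) z = ps a z + ps b z := by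
  rw [← ((ps_hasSum ha hz).add (ps_hasSum hb hz)).tsum_eq, ps]
  simp only [add_mul]

theorem ps_const_mul (a : ℕ → ℂ) (c z : ℂ) : ps (fun n => c * a n) z = c * ps a z := by
  simp only [ps, mul_assoc, tsum_mul_left]

theorem ps_zero_right (a : ℕ → ℂ) : ps a 0 = a 0 := by
  rw [ps, tsum_eq_single 0]
  · simp
  · intro n hn; simp [hn]

/-- Splitting off the constant coefficient. -/
theorem ps_eq_head_add {a : ℕ → ℂ} (ha : PolyGrowth a) {z : ℂ} (hz : ‖z‖ < 1) :
    ps a z = a 0 + z * ps (fun n => a (n + 1)) z := by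
  rw [ps, (ha.summable hz).tsum_eq_zero_add]
  simp only [pow_zero, mul_one, ps, ← tsum_mul_left]
  congr 2
  ext n; ring

/-- Termwise differentiation on a ball of intermediate radius `r`, where the differentiated series
is dominated by its values at `r`. -/
theorem ps_hasDerivAt {a : ℕ → ℂ} (ha : PolyGrowth a) {z : ℂ} (hz : ‖z‖ < 1) :
    HasDerivAt (ps a) (ps (fun n => ((n : ℂ) + 1) * a (n + 1)) z) z := by
  obtain ⟨r, hzr, hr1⟩ := exists_between hz
  have hr0 : 0 ≤ r := (norm_nonneg z).trans hzr.le
  have hD : PolyGrowth fun n => ((n : ℂ) + 1) * a (n + 1) :=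
    PolyGrowth.natCast_add_one.mul ha.shift
  have hu : Summable fun n : ℕ => ‖(n : ℂ) * a n‖ * r ^ (n - 1) := by
    rw [← summable_nat_add_iff 1]
    have := hD.summable_norm (z := (r : ℂ)) (by simpa [abs_of_nonneg hr0] using hr1)
    refine this.congr fun n => ?_
    simp [abs_of_nonneg hr0]
  have key := hasDerivAt_tsum_of_isPreconnected (g := fun n z => a n * z ^ n)
    (g' := fun n z => a n * (n * z ^ (n - 1))) (y₀ := 0) (y := z) hu
    (Metric.isOpen_ball (x := (0 : ℂ)) (ε := r))
    ((convex_ball (0 : ℂ) r).isPreconnected)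
    (fun n y _ => (hasDerivAt_pow n y).const_mul (a n))
    (fun n y hy => ?_) (by simpa using (norm_nonneg z).trans_lt hzr)
    (ha.summable (by simp)) (by simpa using hzr)
  · refine key.congr_deriv ?_
    have hs : Summable fun n => a n * ((n : ℂ) * z ^ (n - 1)) := by
      rw [← summable_nat_add_iff 1]
      refine (hD.summable hz).congr fun n => ?_
      simp; ring
    rw [hs.tsum_eq_zero_add, ps]
    simp only [Nat.cast_zero, zero_mul, mul_zero, zero_add]
    congr 1; ext n; simp; ring
  · have hy' : ‖y‖ ≤ r := by simpa using (Metric.mem_ball.1 hy).le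
    rw [norm_mul, norm_mul, norm_mul, norm_pow, ← mul_assoc, mul_comm ‖a n‖]
    gcongr

theorem mul_ps_deriv {a : ℕ → ℂ} (ha : PolyGrowth a) {z : ℂ} (hz : ‖z‖ < 1) :
    z * ps (fun n => ((n : ℂ) + 1) * a (n + 1)) z = ps (fun n => (n : ℂ) * a n) z := by
  have : PolyGrowth fun n => (n : ℂ) * a n := by
    refine (PolyGrowth.natCast_add_one.mul ha).of_le fun n => ?_
    rw [norm_mul, norm_mul]
    gcongr
    have := Complex.norm_natCast (n + 1)
    push_cast at this
    rw [this, Complex.norm_natCast]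
    linarith
  rw [ps_eq_head_add this hz]
  simp

theorem ps_continuousOn {a : ℕ → ℂ} (ha : PolyGrowth a) :
    ContinuousOn (ps a) {z | ‖z‖ < 1} := fun _ hz =>
  (ps_hasDerivAt ha hz).continuousAt.continuousWithinAt

/-- Abel's limit theorem. -/
theorem ps_tendsto_one {a : ℕ → ℂ} {l : ℂ}
    (h : Tendsto (fun n => ∑ i ∈ range n, a i) atTop (𝓝 l)) :
    Tendsto (fun u : ℝ => ps a (u : ℂ)) (𝓝[<] 1) (𝓝 l) := by
  have := Complex.tendsto_tsum_powerSeries_nhdsWithin_lt h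
  rwa [tendsto_map'_iff] at this

/-- A function on `[0, 1)` vanishing at `0` is determined by its derivative on `(0, 1)`. -/
theorem eqOn_of_hasDerivAt_eq {F G F' : ℝ → ℂ} (hF : ContinuousOn F (Set.Ico 0 1))
    (hG : ContinuousOn G (Set.Ico 0 1)) (h0 : F 0 = G 0)
    (hF' : ∀ u ∈ Set.Ioo (0 : ℝ) 1, HasDerivAt F (F' u) u)
    (hG' : ∀ u ∈ Set.Ioo (0 : ℝ) 1, HasDerivAt G (F' u) u) :
    ∀ u ∈ Set.Ico (0 : ℝ) 1, F u = G u := by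
  obtain ⟨c, hc⟩ := (isOpen_Ioo (a := (0 : ℝ)) (b := 1)).exists_is_const_of_deriv_eq_zero
    isPreconnected_Ioo (f := fun u => F u - G u)
    (fun u hu => ((hF' u hu).sub (hG' u hu)).differentiableAt.differentiableWithinAt)
    (fun u hu => (((hF' u hu).sub (hG' u hu)).congr_deriv (sub_self _)).deriv)
  have hcont : ContinuousOn (fun u => F u - G u) (Set.Ico 0 1) := hF.sub hG
  have hlim : Tendsto (fun u => F u - G u) (𝓝[Set.Ioo 0 1] 0) (𝓝 (F 0 - G 0)) :=
    (hcont 0 (by simp)).mono_left (nhdsWithin_mono _ Set.Ioo_subset_Ico_self)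
  have hne : (𝓝[Set.Ioo (0 : ℝ) 1] 0).NeBot := by
    rw [nhdsWithin_Ioo_eq_nhdsGT zero_lt_one]; infer_instance
  have hc0 : c = 0 := by
    have h2 : Tendsto (fun u => F u - G u) (𝓝[Set.Ioo 0 1] 0) (𝓝 c) :=
      tendsto_const_nhds.congr' (by
        filter_upwards [self_mem_nhdsWithin] with u hu using (hc u hu).symm)
    rw [tendsto_nhds_unique h2 hlim, h0, sub_self]
  rintro u ⟨hu0, hu1⟩
  rcases hu0.eq_or_lt with rfl | hu0
  · exact h0
  · exact sub_eq_zero.1 ((hc u ⟨hu0, hu1⟩).trans hc0)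

/-! ### Growth of truncated polylogarithms. -/

theorem harmonic_mono {m n : ℕ} (h : m ≤ n) : (harmonic m : ℝ) ≤ harmonic n := by
  simp only [harmonic_eq_sum_Icc, Rat.cast_sum]
  exact sum_le_sum_of_subset_of_nonneg (Icc_subset_Icc_right h) fun i _ _ => by positivity

theorem harmonic_cast_nonneg (n : ℕ) : (0 : ℝ) ≤ harmonic n := by
  simpa using harmonic_mono (Nat.zero_le n)

/-- Powers of harmonic numbers grow more slowly than the fourth root. -/
theorem exists_harmonic_pow_le (j : ℕ) :
    ∃ K : ℝ, 0 ≤ K ∧ ∀ n : ℕ, (harmonic n : ℝ) ^ j ≤ K * ((n : ℝ) + 1) ^ (1 / 4 : ℝ) := by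
  -- Chosen so that `ε * j ≤ 1 / 4`. An exponent below `1 / 2` is what (a) and (c) require, as `b_n`
  -- grows like `√n`.
  set ε : ℝ := 1 / (4 * (j + 1)) with hε
  have hε0 : 0 < ε := by positivity
  refine ⟨(1 + 1 / ε) ^ j, by positivity, fun n => ?_⟩
  have hn : (1 : ℝ) ≤ (n : ℝ) + 1 := by simp
  have h1 : (harmonic n : ℝ) ≤ (1 + 1 / ε) * ((n : ℝ) + 1) ^ ε := by
    have h2 := harmonic_mono (Nat.le_succ n)
    have h3 := harmonic_le_one_add_log (n + 1)
    have h4 := Real.log_le_rpow_div (zero_le_one.trans hn) hε0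
    have h5 : 1 ≤ ((n : ℝ) + 1) ^ ε := Real.one_le_rpow hn hε0.le
    push_cast at h3
    calc (harmonic n : ℝ) ≤ 1 + ((n : ℝ) + 1) ^ ε / ε := by linarith
      _ ≤ ((n : ℝ) + 1) ^ ε + ((n : ℝ) + 1) ^ ε / ε := by gcongr
      _ = _ := by ring
  calc (harmonic n : ℝ) ^ j ≤ ((1 + 1 / ε) * ((n : ℝ) + 1) ^ ε) ^ j := by
        gcongr; exact harmonic_cast_nonneg n
    _ = (1 + 1 / ε) ^ j * ((n : ℝ) + 1) ^ (ε * j) := by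
        rw [mul_pow, ← Real.rpow_natCast (((n : ℝ) + 1) ^ ε), ← Real.rpow_mul (by positivity)]
    _ ≤ _ := by
        gcongr
        · rw [hε, div_mul_eq_mul_div, div_le_div_iff₀ (by positivity) (by norm_num)]
          linarith

/-- The entries of the index are positive integers paired with fourth roots of unity. -/
def IsWord (a : List (ℕ × ℂ)) : Prop := ∀ x ∈ a, 0 < x.1 ∧ x.2 ^ 4 = 1

theorem norm_eq_one_of_pow_four {z : ℂ} (h : z ^ 4 = 1) : ‖z‖ = 1 :=
  (pow_eq_one_iff_of_nonneg (norm_nonneg z) (n := 4) (by norm_num)).1 (by rw [← norm_pow, h, norm_one])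

theorem norm_liTrunc_le {a : List (ℕ × ℂ)} (ha : IsWord a) (M : ℕ) :
    ‖liTrunc a M‖ ≤ (harmonic M : ℝ) ^ a.length := by
  induction a generalizing M with
  | nil => simp [liTrunc]
  | cons x as ih =>
    have hx := ha x (by simp)
    have has : IsWord as := fun y hy => ha y (by simp [hy])
    rw [liTrunc, List.length_cons, pow_succ']
    nth_rewrite 1 [harmonic_eq_sum_Icc]
    rw [Rat.cast_sum, sum_mul]
    refine (norm_sum_le _ _).trans (sum_le_sum fun n hn => ?_)
    obtain ⟨h1, h2⟩ := mem_Icc.1 hn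
    rw [norm_mul, norm_div, norm_pow, norm_eq_one_of_pow_four hx.2, one_pow, norm_pow,
      Complex.norm_natCast]
    have hn1 : (1 : ℝ) ≤ n := by exact_mod_cast h1
    gcongr
    · rw [one_div, Rat.cast_inv, Rat.cast_natCast]
      gcongr
      exact le_self_pow₀ hn1 hx.1.ne'
    · exact (ih has _).trans (pow_le_pow_left₀ (harmonic_cast_nonneg _) (harmonic_mono (by omega)) _)

theorem exists_norm_liTrunc_le {a : List (ℕ × ℂ)} (ha : IsWord a) :
    ∃ K : ℝ, 0 ≤ K ∧ ∀ n : ℕ, ‖liTrunc a n‖ ≤ K * ((n : ℝ) + 1) ^ (1 / 4 : ℝ) := by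
  obtain ⟨K, hK, h⟩ := exists_harmonic_pow_le a.length
  exact ⟨K, hK, fun n => (norm_liTrunc_le ha n).trans (h n)⟩

/-- Bounds the variation of the inner sum for Dirichlet's test: the increment is a shorter truncated
sum divided by a positive power of `n + 1`. -/
theorem exists_norm_liTrunc_diff_le {a : List (ℕ × ℂ)} (ha : IsWord a) :
    ∃ K : ℝ, 0 ≤ K ∧ ∀ n : ℕ, ‖((n : ℂ) + 1) * (liTrunc a (n + 1) - liTrunc a n)‖
      ≤ K * ((n : ℝ) + 1) ^ (1 / 4 : ℝ) := by
  cases a with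
  | nil => exact ⟨0, le_rfl, fun n => by simp [liTrunc]⟩
  | cons x as =>
    obtain ⟨hx0, hx4⟩ := ha x (by simp)
    obtain ⟨K, hK, h⟩ := exists_norm_liTrunc_le (a := as) fun y hy => ha y (by simp [hy])
    refine ⟨K, hK, fun n => le_trans ?_ (h n)⟩
    have n1 : ‖(n : ℂ) + 1‖ = (n : ℝ) + 1 := by simpa using Complex.norm_natCast (n + 1)
    rw [liTrunc, liTrunc, sum_Icc_succ_top (by omega), add_sub_cancel_left, norm_mul, norm_mul,
      norm_div, norm_pow, norm_pow, norm_eq_one_of_pow_four hx4, one_pow, Nat.add_sub_cancel,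
      ← mul_assoc]
    push_cast
    rw [n1]
    refine mul_le_of_le_one_left (norm_nonneg _) ?_
    rw [mul_one_div]
    exact div_le_one_of_le₀ (le_self_pow₀ (by simp) hx0.ne') (by positivity)

theorem polyGrowth_liTrunc {a : List (ℕ × ℂ)} (ha : IsWord a) : PolyGrowth (liTrunc a) := by
  obtain ⟨K, hK, h⟩ := exists_norm_liTrunc_le ha
  refine ⟨K, 1, hK, fun n => (h n).trans ?_⟩
  rw [pow_one]
  gcongr
  exact Real.rpow_le_self_of_one_le (by simp) (by norm_num)

/-! ### Coefficient sequences of words and their convergence at 1. -/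

/-- The coefficients of the one-variable multiple polylogarithm attached to a word. -/
noncomputable def wordCoeff : List (ℕ × ℂ) → ℕ → ℂ
  | [], n => if n = 0 then 1 else 0
  | x :: as, n => x.2 ^ n / (n : ℂ) ^ x.1 * liTrunc as (n - 1)

theorem polyGrowth_wordCoeff {a : List (ℕ × ℂ)} (ha : IsWord a) : PolyGrowth (wordCoeff a) := by
  cases a with
  | nil => exact PolyGrowth.of_bounded 1 fun n => by rw [wordCoeff]; split_ifs <;> simp
  | cons x as =>
    have h := (polyGrowth_liTrunc (a := as) fun y hy => ha y (by simp [hy])).pred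
    refine (PolyGrowth.mul (PolyGrowth.of_bounded 1 fun n => ?_) h)
    rw [norm_div, norm_pow, norm_eq_one_of_pow_four (ha x (by simp)).2, one_pow, norm_pow,
      Complex.norm_natCast]
    rcases Nat.eq_zero_or_pos n with rfl | hn
    · simp [(ha x (by simp)).1.ne']
    · exact div_le_self zero_le_one (one_le_pow₀ (by exact_mod_cast hn))

theorem wordCoeff_cons_zero {x : ℕ × ℂ} (hx : 0 < x.1) (as : List (ℕ × ℂ)) :
    wordCoeff (x :: as) 0 = 0 := by simp [wordCoeff, hx.ne']

theorem sum_wordCoeff {x : ℕ × ℂ} (hx : 0 < x.1) (as : List (ℕ × ℂ)) (M : ℕ) :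
    ∑ n ∈ range (M + 1), wordCoeff (x :: as) n = liTrunc (x :: as) M := by
  rw [sum_range_succ', wordCoeff_cons_zero hx, add_zero, liTrunc, range_eq_Ico,
    Finset.sum_Ico_add' (fun n => wordCoeff (x :: as) n) 0 M 1]
  rfl

theorem summable_rpow_bound (K : ℝ) :
    Summable fun n : ℕ => K * ((n : ℝ) + 1) ^ (-(7 / 4) : ℝ) := by
  have h := (Real.summable_nat_rpow (p := -(7 / 4))).2 (by norm_num)
  have := ((summable_nat_add_iff 1).2 h).mul_left K
  simpa using this

theorem rpow_quarter_div_sq {x : ℝ} (hx : 0 < x) :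
    x ^ (1 / 4 : ℝ) / x ^ 2 = x ^ (-(7 / 4) : ℝ) := by
  rw [← Real.rpow_natCast, ← Real.rpow_sub hx]
  norm_num

/-- Dirichlet's test by partial summation, for a bounded-variation null sequence. -/
theorem exists_tendsto_sum_pow_mul {z : ℂ} (hz : ‖z‖ = 1) (hz1 : z ≠ 1) {d : ℕ → ℂ}
    (hd : Tendsto d atTop (𝓝 0)) (hs : Summable fun n => ‖d (n + 1) - d n‖) :
    ∃ v, Tendsto (fun M => ∑ n ∈ range M, z ^ n * d n) atTop (𝓝 v) := by
  -- Summation by parts: multiplying by `1 - z` moves the sum onto the increments of `d`.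
  have key : ∀ M, ∑ n ∈ range M, z ^ n * d n
      = (1 - z)⁻¹ * (∑ n ∈ range M, z ^ (n + 1) * (d (n + 1) - d n) - z ^ M * d M + d 0) := by
    intro M
    have h1 : 1 - z ≠ 0 := sub_ne_zero.2 hz1.symm
    rw [eq_inv_mul_iff_mul_eq₀ h1]
    induction M with
    | zero => simp
    | succ M ih =>
      rw [sum_range_succ, sum_range_succ, mul_add, ih]
      ring
  have h1 : Summable fun n => z ^ (n + 1) * (d (n + 1) - d n) :=
    Summable.of_norm (hs.congr fun n => by rw [norm_mul, norm_pow, hz, one_pow, one_mul])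
  have h2 : Tendsto (fun M => z ^ M * d M) atTop (𝓝 0) := by
    refine squeeze_zero_norm (fun n => ?_) (tendsto_zero_iff_norm_tendsto_zero.1 hd)
    rw [norm_mul, norm_pow, hz, one_pow, one_mul]
  refine ⟨_, (((h1.hasSum.tendsto_sum_nat.sub h2).add_const (d 0)).const_mul (1 - z)⁻¹).congr
    fun M => (key M).symm⟩

theorem exists_tendsto_sum_wordCoeff {x : ℕ × ℂ} {as : List (ℕ × ℂ)} (ha : IsWord (x :: as))
    (hx : x ≠ (1, 1)) :
    ∃ v, Tendsto (fun M => ∑ n ∈ range M, wordCoeff (x :: as) n) atTop (𝓝 v) := by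
  obtain ⟨hx0, hx4⟩ := ha x (by simp)
  have has : IsWord as := fun y hy => ha y (by simp [hy])
  obtain ⟨K, hK, hT⟩ := exists_norm_liTrunc_le has
  obtain ⟨K', hK', hT'⟩ := exists_norm_liTrunc_diff_le has
  have hz := norm_eq_one_of_pow_four hx4
  rcases Nat.lt_or_ge 1 x.1 with h2 | h2
  · refine ⟨_, (Summable.hasSum (Summable.of_norm ?_)).tendsto_sum_nat⟩
    rw [← summable_nat_add_iff 1]
    refine Summable.of_nonneg_of_le (fun _ => norm_nonneg _) (fun n => ?_) (summable_rpow_bound K)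
    rw [wordCoeff, norm_mul, norm_div, norm_pow, hz, one_pow, norm_pow, Complex.norm_natCast,
      Nat.add_sub_cancel, ← rpow_quarter_div_sq (by positivity)]
    calc 1 / ((n + 1 : ℕ) : ℝ) ^ x.1 * ‖liTrunc as n‖
        ≤ 1 / ((n : ℝ) + 1) ^ 2 * (K * ((n : ℝ) + 1) ^ (1 / 4 : ℝ)) := by
          push_cast
          gcongr
          · simp
          · omega
          · exact hT n
      _ = _ := by ring
  · have hx1 : x.1 = 1 := by omega
    have hz1 : x.2 ≠ 1 := fun h => hx (Prod.ext hx1 h)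
    -- With leading exponent 1 only the oscillation of `x.2 ^ n` gives convergence; the remaining
    -- factor tends to zero with increments of order `n ^ (-7/4)`.
    suffices hds : Tendsto (fun n : ℕ => liTrunc as (n - 1) / n) atTop (𝓝 0) ∧
        Summable fun n : ℕ => ‖liTrunc as (n + 1 - 1) / (n + 1 : ℕ) - liTrunc as (n - 1) / n‖ by
      obtain ⟨v, hv⟩ := exists_tendsto_sum_pow_mul hz hz1 hds.1 hds.2
      refine ⟨v, hv.congr fun M => sum_congr rfl fun n _ => ?_⟩
      rw [wordCoeff, hx1, pow_one]; ring
    constructor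
    · rw [← tendsto_add_atTop_iff_nat 1]
      have hl : Tendsto (fun n : ℕ => K * ((n : ℝ) + 1) ^ (-(3 / 4) : ℝ)) atTop (𝓝 0) := by
        have h := (tendsto_rpow_neg_atTop (y := 3 / 4) (by norm_num)).comp
          (tendsto_natCast_atTop_atTop.comp (tendsto_add_atTop_nat 1))
        simpa using h.const_mul K
      refine squeeze_zero_norm (fun n => ?_) hl
      rw [norm_div, Complex.norm_natCast, Nat.add_sub_cancel, div_le_iff₀ (by positivity)]
      refine (hT n).trans (le_of_eq ?_)
      have hp : (0 : ℝ) < (n : ℝ) + 1 := by positivity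
      push_cast
      rw [mul_assoc, ← Real.rpow_add_one hp.ne']
      norm_num
    · rw [← summable_nat_add_iff 1]
      refine Summable.of_nonneg_of_le (fun _ => norm_nonneg _) (fun n => ?_)
        (summable_rpow_bound (K' + K))
      have hp : (0 : ℝ) < (n : ℝ) + 1 := by positivity
      have hc : ((n : ℂ) + 1) ≠ 0 := by exact_mod_cast Nat.succ_ne_zero n
      have hc2 : ((n : ℂ) + 2) ≠ 0 := by exact_mod_cast Nat.succ_ne_zero (n + 1)
      have e1 : liTrunc as (n + 1 + 1 - 1) / ((n + 1 + 1 : ℕ) : ℂ)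
          - liTrunc as (n + 1 - 1) / ((n + 1 : ℕ) : ℂ)
          = (((n : ℂ) + 1) * (liTrunc as (n + 1) - liTrunc as n) - liTrunc as n)
            / (((n : ℂ) + 1) * ((n : ℂ) + 2)) := by
        rw [Nat.add_sub_cancel, Nat.add_sub_cancel]
        push_cast
        have : ((n : ℂ) + 1 + 1) ≠ 0 := by rw [add_assoc]; norm_num; exact hc2
        field_simp
        ring
      simp only [Nat.add_sub_cancel] at e1 ⊢
      rw [e1, norm_div, norm_mul]
      have n1 : ‖(n : ℂ) + 1‖ = (n : ℝ) + 1 := by simpa using Complex.norm_natCast (n + 1)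
      have n2 : ‖(n : ℂ) + 2‖ = (n : ℝ) + 2 := by simpa using Complex.norm_natCast (n + 2)
      rw [n1, n2, ← rpow_quarter_div_sq hp]
      calc _ ≤ (K' * ((n : ℝ) + 1) ^ (1 / 4 : ℝ) + K * ((n : ℝ) + 1) ^ (1 / 4 : ℝ))
            / (((n : ℝ) + 1) * ((n : ℝ) + 1)) := by
            gcongr
            · exact (norm_sub_le _ _).trans (add_le_add (hT' n) (hT n))
            · norm_num
        _ = _ := by ring

/-- The `ℚ`-span of the coefficient sequences of the level four polylogarithms of weight `w`. -/
noncomputable def polySpan (w : ℕ) : Submodule ℚ (ℕ → ℂ) :=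
  Submodule.span ℚ {c | ∃ a, IsWord a ∧ (a.map Prod.fst).sum = w ∧ c = wordCoeff a}

/-- The span of those level four polylogarithms which converge at `1`. -/
noncomputable def convSpan (w : ℕ) : Submodule ℚ (ℕ → ℂ) :=
  Submodule.span ℚ {c | ∃ x as, IsWord (x :: as) ∧ x ≠ (1, 1) ∧
    ((x :: as).map Prod.fst).sum = w ∧ c = wordCoeff (x :: as)}

theorem convSpan_le (w : ℕ) : convSpan w ≤ polySpan w :=
  Submodule.span_mono fun _ ⟨x, as, h1, _, h2, h3⟩ => ⟨x :: as, h1, h2, h3⟩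

theorem polyGrowth_of_mem {w : ℕ} {c : ℕ → ℂ} (hc : c ∈ polySpan w) : PolyGrowth c := by
  induction hc using Submodule.span_induction with
  | mem c h => obtain ⟨a, ha, -, rfl⟩ := h; exact polyGrowth_wordCoeff ha
  | zero => exact PolyGrowth.const 0
  | add a b _ _ ha hb => exact ha.add hb
  | smul q a _ ha =>
    have : q • a = fun n => (q : ℂ) * a n := by
      ext n; simp [Rat.smul_def]
    rw [this]
    exact ha.const_mul _

theorem exists_tendsto_of_mem_convSpan {w : ℕ} {c : ℕ → ℂ} (hc : c ∈ convSpan w) :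
    ∃ v ∈ CMZV 4 w, Tendsto (fun M => ∑ n ∈ range M, c n) atTop (𝓝 v) := by
  induction hc using Submodule.span_induction with
  | mem c h =>
    obtain ⟨x, as, ha, hx, hw, rfl⟩ := h
    obtain ⟨v, hv⟩ := exists_tendsto_sum_wordCoeff ha hx
    refine ⟨v, Submodule.subset_span ⟨x :: as, ha, by simpa using hx, hw, ?_⟩, hv⟩
    refine ((tendsto_add_atTop_iff_nat 1).2 hv).congr fun M => sum_wordCoeff (ha x (by simp)).1 as M
  | zero => exact ⟨0, zero_mem _, by simp⟩
  | add a b _ _ ha hb =>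
    obtain ⟨v, hv, h⟩ := ha
    obtain ⟨v', hv', h'⟩ := hb
    exact ⟨v + v', add_mem hv hv', (h.add h').congr fun M => by simp [sum_add_distrib]⟩
  | smul q a _ ha =>
    obtain ⟨v, hv, h⟩ := ha
    refine ⟨q • v, Submodule.smul_mem _ q hv, (h.const_smul q).congr fun M => ?_⟩
    simp [smul_sum]

/-! ### Integration of polylogarithms against the level four forms. -/

/-- Integration against `du / u`, on coefficients. -/
noncomputable def intZero : (ℕ → ℂ) →ₗ[ℚ] (ℕ → ℂ) where
  toFun a n := a n / n
  map_add' a b := by ext n; simp [add_div]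
  map_smul' q a := by ext n; simp [Rat.smul_def, mul_div_assoc]

/-- Integration against `ξ du / (1 - ξ u)`, on coefficients. -/
noncomputable def intRoot (ξ : ℂ) : (ℕ → ℂ) →ₗ[ℚ] (ℕ → ℂ) where
  toFun a n := ξ ^ n / n * ∑ m ∈ range n, ξ⁻¹ ^ m * a m
  map_add' a b := by ext n; simp [mul_add, sum_add_distrib]
  map_smul' q a := by
    ext n
    simp only [Pi.smul_apply, Rat.smul_def, RingHom.id_apply, mul_sum]
    refine sum_congr rfl fun m _ => ?_
    ring

theorem map_mem_of_forall_word {w : ℕ} {f : (ℕ → ℂ) →ₗ[ℚ] (ℕ → ℂ)} {S : Submodule ℚ (ℕ → ℂ)}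
    (h : ∀ a, IsWord a → (a.map Prod.fst).sum = w → f (wordCoeff a) ∈ S) {c : ℕ → ℂ}
    (hc : c ∈ polySpan w) : f c ∈ S := by
  have : polySpan w ≤ S.comap f := Submodule.span_le.2 (by
    rintro _ ⟨a, ha, hw, rfl⟩
    exact h a ha hw)
  exact this hc

/-- Raising the leading exponent makes it at least 2, whence convergence at 1. Weight 0 is excluded
because `du / u` cannot be integrated from 0 against the constant 1. -/
theorem intZero_mem {w : ℕ} (hw : 1 ≤ w) {c : ℕ → ℂ} (hc : c ∈ polySpan w) :
    intZero c ∈ convSpan (w + 1) := by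
  refine map_mem_of_forall_word (fun a ha haw => ?_) hc
  cases a with
  | nil => simp at haw; omega
  | cons x as =>
    refine Submodule.subset_span ⟨(x.1 + 1, x.2), as, ?_, ?_, ?_, ?_⟩
    · intro y hy
      rcases List.mem_cons.1 hy with rfl | hy
      · exact ⟨Nat.succ_pos _, (ha x (by simp)).2⟩
      · exact ha y (by simp [hy])
    · have := (ha x (by simp)).1
      intro h
      have := congrArg Prod.fst h
      simp at this
      omega
    · simp at haw ⊢; omega
    · ext n
      simp only [intZero, LinearMap.coe_mk, AddHom.coe_mk, wordCoeff]
      rw [pow_succ]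
      ring

/-- Partial sums of `ξ⁻¹ ^ m` times the coefficients form a truncated polylogarithm with leading
root rotated by `ξ⁻¹`; the outer factor `ξ ^ n / n` is the new letter `(1, ξ)`. -/
theorem intRoot_word {ξ : ℂ} (hξ : ξ ^ 4 = 1) {a : List (ℕ × ℂ)} (ha : IsWord a) :
    ∃ as, IsWord ((1, ξ) :: as) ∧ (as.map Prod.fst).sum = (a.map Prod.fst).sum ∧
      intRoot ξ (wordCoeff a) = wordCoeff ((1, ξ) :: as) := by
  cases a with
  | nil =>
    refine ⟨[], by simpa [IsWord] using hξ, rfl, ?_⟩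
    ext n
    simp only [intRoot, LinearMap.coe_mk, AddHom.coe_mk, wordCoeff, liTrunc, pow_one]
    rcases Nat.eq_zero_or_pos n with rfl | hn
    · simp
    · simp [hn.ne']
  | cons x as =>
    refine ⟨(x.1, ξ⁻¹ * x.2) :: as, ?_, rfl, ?_⟩
    · intro y hy
      rcases List.mem_cons.1 hy with rfl | hy
      · exact ⟨one_pos, hξ⟩
      rcases List.mem_cons.1 hy with rfl | hy
      · refine ⟨(ha x (by simp)).1, ?_⟩
        rw [mul_pow, inv_pow, hξ, (ha x (by simp)).2]; simp
      · exact ha y (by simp [hy])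
    · ext n
      rcases Nat.eq_zero_or_pos n with rfl | hn
      · simp [intRoot, wordCoeff]
      · obtain ⟨m, rfl⟩ : ∃ m, n = m + 1 := ⟨n - 1, by omega⟩
        rw [wordCoeff, Nat.add_sub_cancel, ← sum_wordCoeff (by exact (ha x (by simp)).1)]
        simp only [intRoot, LinearMap.coe_mk, AddHom.coe_mk, wordCoeff, pow_one]
        congr 1
        refine sum_congr rfl fun i _ => ?_
        rw [mul_pow]; ring

theorem intRoot_mem {ξ : ℂ} (hξ : ξ ^ 4 = 1) {w : ℕ} {c : ℕ → ℂ} (hc : c ∈ polySpan w) :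
    intRoot ξ c ∈ polySpan (w + 1) := by
  refine map_mem_of_forall_word (fun a ha haw => ?_) hc
  obtain ⟨as, h1, h2, h3⟩ := intRoot_word hξ ha
  exact Submodule.subset_span ⟨_, h1, by simp [h2, haw, add_comm], h3⟩

theorem intRoot_mem_conv {ξ : ℂ} (hξ : ξ ^ 4 = 1) (hξ1 : ξ ≠ 1) {w : ℕ} {c : ℕ → ℂ}
    (hc : c ∈ polySpan w) : intRoot ξ c ∈ convSpan (w + 1) := by
  refine map_mem_of_forall_word (fun a ha haw => ?_) hc
  obtain ⟨as, h1, h2, h3⟩ := intRoot_word hξ ha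
  exact Submodule.subset_span ⟨_, _, h1, by simpa using hξ1, by simp [h2, haw, add_comm], h3⟩

theorem apply_zero_of_mem {w : ℕ} (hw : 1 ≤ w) {c : ℕ → ℂ} (hc : c ∈ polySpan w) : c 0 = 0 := by
  induction hc using Submodule.span_induction with
  | mem c h =>
    obtain ⟨a, ha, haw, rfl⟩ := h
    cases a with
    | nil => simp at haw; omega
    | cons x as => exact wordCoeff_cons_zero (ha x (by simp)).1 as
  | zero => rfl
  | add a b _ _ ha hb => simp [ha, hb]
  | smul q a _ ha => simp [ha]

theorem intZero_hasDerivAt {c : ℕ → ℂ} (hc : PolyGrowth c) (h0 : c 0 = 0) {z : ℂ} (hz : ‖z‖ < 1)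
    (hz0 : z ≠ 0) : HasDerivAt (ps (intZero c)) (1 / z * ps c z) z := by
  have hg : PolyGrowth (intZero c) := by
    have := hc.div_pow (d := fun n => n) 1
    simpa [intZero] using this
  refine (ps_hasDerivAt hg hz).congr_deriv ?_
  rw [ps_eq_head_add hc hz, h0, zero_add, ← mul_assoc, one_div_mul_cancel hz0, one_mul]
  congr 1
  ext n
  have : (n : ℂ) + 1 ≠ 0 := by exact_mod_cast Nat.succ_ne_zero n
  simp only [intZero, LinearMap.coe_mk, AddHom.coe_mk]
  push_cast
  field_simp

theorem intRoot_polyGrowth {ξ : ℂ} (hξ : ‖ξ‖ = 1) {c : ℕ → ℂ} (hc : PolyGrowth c) :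
    PolyGrowth (intRoot ξ c) := by
  refine PolyGrowth.mul (PolyGrowth.of_bounded 1 fun n => ?_) (PolyGrowth.sum_range ?_)
  · rw [norm_div, norm_pow, hξ, one_pow, Complex.norm_natCast]
    rcases Nat.eq_zero_or_pos n with rfl | hn
    · simp
    · exact div_le_self zero_le_one (by exact_mod_cast hn)
  · exact hc.of_le fun n => by simp [hξ]

theorem intRoot_hasDerivAt {ξ : ℂ} (hξ : ‖ξ‖ = 1) {c : ℕ → ℂ} (hc : PolyGrowth c) {z : ℂ}
    (hz : ‖z‖ < 1) : HasDerivAt (ps (intRoot ξ c)) (ξ / (1 - ξ * z) * ps c z) z := by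
  have hg := intRoot_polyGrowth hξ hc
  have hξ0 : ξ ≠ 0 := by rintro rfl; simp at hξ
  refine (ps_hasDerivAt hg hz).congr_deriv ?_
  set e : ℕ → ℂ := fun n => ((n : ℂ) + 1) * intRoot ξ c (n + 1) with he
  have hpe : PolyGrowth e := PolyGrowth.natCast_add_one.mul hg.shift
  have he' : ∀ n, e n = ξ ^ (n + 1) * ∑ m ∈ range (n + 1), ξ⁻¹ ^ m * c m := by
    intro n
    have : (n : ℂ) + 1 ≠ 0 := by exact_mod_cast Nat.succ_ne_zero n
    simp only [he, intRoot, LinearMap.coe_mk, AddHom.coe_mk]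
    push_cast
    field_simp
  -- Coefficient form of `(1 - ξ z) E = ξ c(z)`, where `E` is the derivative sought.
  have hs : ∀ n, e (n + 1) = ξ * e n + ξ * c (n + 1) := by
    intro n
    rw [he', he', sum_range_succ _ (n + 1), mul_add]
    congr 1
    · ring
    · rw [inv_pow, pow_succ ξ (n + 1)]
      field_simp
  have h1 : 1 - ξ * z ≠ 0 := by
    intro h
    have : ‖ξ * z‖ = 1 := by rw [← sub_eq_zero.1 h, norm_one]
    rw [norm_mul, hξ, one_mul] at this
    exact hz.ne this
  have key : ps e z = ξ * z * ps e z + ξ * ps c z := by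
    have e1 := ps_eq_head_add hpe hz
    simp only [hs] at e1
    rw [ps_add (hpe.const_mul _) (hc.shift.const_mul _) hz, ps_const_mul, ps_const_mul] at e1
    have e0 : e 0 = ξ * c 0 := by rw [he']; simp
    rw [ps_eq_head_add hc hz]
    linear_combination e1 + e0
  rw [div_mul_eq_mul_div, eq_div_iff h1]
  linear_combination key

/-- The differential forms of level four, with rational coefficients. -/
noncomputable def form (q₀ q₁ q₂ q₃ q₄ : ℚ) (u : ℝ) : ℂ :=
  q₀ * (1 / u) + q₁ * (1 / (1 - u)) + q₂ * (-1 / (1 + u)) +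
    q₃ * (Complex.I / (1 - Complex.I * u)) + q₄ * (-Complex.I / (1 + Complex.I * u))

/-- Integration against `form`, on coefficients. -/
noncomputable def intForm (q₀ q₁ q₂ q₃ q₄ : ℚ) : (ℕ → ℂ) →ₗ[ℚ] (ℕ → ℂ) :=
  q₀ • intZero + q₁ • intRoot 1 + q₂ • intRoot (-1) + q₃ • intRoot Complex.I +
    q₄ • intRoot (-Complex.I)

theorem neg_I_pow_four : (-Complex.I) ^ 4 = 1 := by
  rw [neg_pow, Complex.I_pow_four]; norm_num

theorem intForm_mem (q₀ q₁ q₂ q₃ q₄ : ℚ) {w : ℕ} (h : 1 ≤ w ∨ q₀ = 0) {c : ℕ → ℂ}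
    (hc : c ∈ polySpan w) : intForm q₀ q₁ q₂ q₃ q₄ c ∈ polySpan (w + 1) := by
  refine add_mem (add_mem (add_mem (add_mem ?_ ?_) ?_) ?_) ?_
  · rcases h with h | rfl
    · exact Submodule.smul_mem _ _ (convSpan_le _ (intZero_mem h hc))
    · simp
  · exact Submodule.smul_mem _ _ (intRoot_mem (by simp) hc)
  · exact Submodule.smul_mem _ _ (intRoot_mem (by norm_num) hc)
  · exact Submodule.smul_mem _ _ (intRoot_mem Complex.I_pow_four hc)
  · exact Submodule.smul_mem _ _ (intRoot_mem neg_I_pow_four hc)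

/-- Only `du / (1 - u)` can create the forbidden leading letter `(1, 1)`. -/
theorem intForm_mem_conv (q₀ q₂ q₃ q₄ : ℚ) {w : ℕ} (h : 1 ≤ w ∨ q₀ = 0) {c : ℕ → ℂ}
    (hc : c ∈ polySpan w) : intForm q₀ 0 q₂ q₃ q₄ c ∈ convSpan (w + 1) := by
  refine add_mem (add_mem (add_mem (add_mem ?_ ?_) ?_) ?_) ?_
  · rcases h with h | rfl
    · exact Submodule.smul_mem _ _ (intZero_mem h hc)
    · simp
  · simp
  · exact Submodule.smul_mem _ _ (intRoot_mem_conv (by norm_num) (by norm_num) hc)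
  · refine Submodule.smul_mem _ _ (intRoot_mem_conv Complex.I_pow_four (fun h => ?_) hc)
    simpa using congrArg Complex.re h
  · refine Submodule.smul_mem _ _ (intRoot_mem_conv neg_I_pow_four (fun h => ?_) hc)
    simpa using congrArg Complex.re h

theorem norm_ofReal_lt_one {u : ℝ} (hu : u ∈ Set.Ico (0 : ℝ) 1) : ‖(u : ℂ)‖ < 1 := by
  simpa [abs_of_nonneg hu.1] using hu.2

theorem intForm_ps (q₀ q₁ q₂ q₃ q₄ : ℚ) {w : ℕ} {c : ℕ → ℂ}
    (hc : c ∈ polySpan w) {z : ℂ} (hz : ‖z‖ < 1) :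
    ps (intForm q₀ q₁ q₂ q₃ q₄ c) z = q₀ * ps (intZero c) z + q₁ * ps (intRoot 1 c) z
      + q₂ * ps (intRoot (-1) c) z + q₃ * ps (intRoot Complex.I c) z
      + q₄ * ps (intRoot (-Complex.I) c) z := by
  have hp := polyGrowth_of_mem hc
  have g0 : PolyGrowth (intZero c) := by
    have := hp.div_pow (d := fun n => n) 1
    simpa [intZero] using this
  have g1 := intRoot_polyGrowth (ξ := 1) (by simp) hp
  have g2 := intRoot_polyGrowth (ξ := -1) (by simp) hp
  have g3 := intRoot_polyGrowth (ξ := Complex.I) (by simp) hp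
  have g4 := intRoot_polyGrowth (ξ := -Complex.I) (by simp) hp
  rw [← ps_const_mul, ← ps_const_mul, ← ps_const_mul, ← ps_const_mul, ← ps_const_mul,
    ← ps_add (g0.const_mul _) (g1.const_mul _) hz,
    ← ps_add ((g0.const_mul _).add (g1.const_mul _)) (g2.const_mul _) hz,
    ← ps_add (((g0.const_mul _).add (g1.const_mul _)).add (g2.const_mul _)) (g3.const_mul _) hz,
    ← ps_add ((((g0.const_mul _).add (g1.const_mul _)).add (g2.const_mul _)).add
      (g3.const_mul _)) (g4.const_mul _) hz]
  congr 1

theorem intForm_hasDerivAt (q₀ q₁ q₂ q₃ q₄ : ℚ) {w : ℕ} (h : 1 ≤ w ∨ q₀ = 0) {c : ℕ → ℂ}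
    (hc : c ∈ polySpan w) {u : ℝ} (hu : u ∈ Set.Ioo (0 : ℝ) 1) :
    HasDerivAt (fun u : ℝ => ps (intForm q₀ q₁ q₂ q₃ q₄ c) u)
      (form q₀ q₁ q₂ q₃ q₄ u * ps c u) u := by
  have hp := polyGrowth_of_mem hc
  have hz := norm_ofReal_lt_one (Set.Ioo_subset_Ico_self hu)
  have hz0 : (u : ℂ) ≠ 0 := by exact_mod_cast hu.1.ne'
  have d0 : HasDerivAt (fun z => (q₀ : ℂ) * ps (intZero c) z) (q₀ * (1 / u * ps c u)) (u : ℂ) := by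
    rcases h with h | rfl
    · exact (intZero_hasDerivAt hp (apply_zero_of_mem h hc) hz hz0).const_mul _
    · simpa using hasDerivAt_const (u : ℂ) (0 : ℂ)
  have d1 := (intRoot_hasDerivAt (ξ := 1) (by simp) hp hz).const_mul (q₁ : ℂ)
  have d2 := (intRoot_hasDerivAt (ξ := -1) (by simp) hp hz).const_mul (q₂ : ℂ)
  have d3 := (intRoot_hasDerivAt (ξ := Complex.I) (by simp) hp hz).const_mul (q₃ : ℂ)
  have d4 := (intRoot_hasDerivAt (ξ := -Complex.I) (by simp) hp hz).const_mul (q₄ : ℂ)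
  have d : HasDerivAt (ps (intForm q₀ q₁ q₂ q₃ q₄ c)) (form q₀ q₁ q₂ q₃ q₄ u * ps c u) (u : ℂ) := by
    refine (((((d0.add d1).add d2).add d3).add d4).congr_of_eventuallyEq ?_).congr_deriv ?_
    · filter_upwards [(isOpen_lt continuous_norm continuous_const).mem_nhds hz] with z hz'
      exact intForm_ps q₀ q₁ q₂ q₃ q₄ hc hz'
    · rw [form]
      simp only [one_mul, neg_mul, sub_neg_eq_add]
      ring
  exact d.comp_ofReal

/-! ### Functions on [0, 1) given by level four polylogarithms. -/

/-- On `[0, 1)` the function `f` is a combination of level four polylogarithms of weight `w`. -/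
def IsPoly (w : ℕ) (f : ℝ → ℂ) : Prop := ∃ c ∈ polySpan w, ∀ u ∈ Set.Ico (0 : ℝ) 1, f u = ps c u

/-- As `IsPoly`, with polylogarithms that converge at `1`. -/
def IsConv (w : ℕ) (f : ℝ → ℂ) : Prop := ∃ c ∈ convSpan w, ∀ u ∈ Set.Ico (0 : ℝ) 1, f u = ps c u

theorem IsConv.isPoly {w : ℕ} {f : ℝ → ℂ} (h : IsConv w f) : IsPoly w f := by
  obtain ⟨c, hc, h⟩ := h
  exact ⟨c, convSpan_le w hc, h⟩

theorem ps_ofReal_continuousOn {c : ℕ → ℂ} (hc : PolyGrowth c) :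
    ContinuousOn (fun u : ℝ => ps c u) (Set.Ico 0 1) :=
  (ps_continuousOn hc).comp Complex.continuous_ofReal.continuousOn fun _ hu => norm_ofReal_lt_one hu

theorem IsConv.exists_tendsto {w : ℕ} {f : ℝ → ℂ} (h : IsConv w f) :
    ∃ v ∈ CMZV 4 w, Tendsto f (𝓝[<] 1) (𝓝 v) := by
  obtain ⟨c, hc, h⟩ := h
  obtain ⟨v, hv, hl⟩ := exists_tendsto_of_mem_convSpan hc
  refine ⟨v, hv, (ps_tendsto_one hl).congr' ?_⟩
  filter_upwards [Ioo_mem_nhdsLT (zero_lt_one (α := ℝ))] with u hu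
  exact (h u (Set.Ioo_subset_Ico_self hu)).symm

theorem IsPoly.add {w : ℕ} {f g : ℝ → ℂ} (hf : IsPoly w f) (hg : IsPoly w g) :
    IsPoly w fun u => f u + g u := by
  obtain ⟨c, hc, h⟩ := hf
  obtain ⟨d, hd, h'⟩ := hg
  refine ⟨c + d, add_mem hc hd, fun u hu => ?_⟩
  simp only [h u hu, h' u hu]
  exact (ps_add (polyGrowth_of_mem hc) (polyGrowth_of_mem hd) (norm_ofReal_lt_one hu)).symm

theorem ps_rat_smul (q : ℚ) (c : ℕ → ℂ) (z : ℂ) : ps (q • c) z = q * ps c z := by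
  rw [← ps_const_mul]; congr 1

theorem IsPoly.const_mul (q : ℚ) {w : ℕ} {f : ℝ → ℂ} (hf : IsPoly w f) :
    IsPoly w fun u => (q : ℂ) * f u := by
  obtain ⟨c, hc, h⟩ := hf
  exact ⟨q • c, Submodule.smul_mem _ q hc, fun u hu => by simp only [h u hu, ps_rat_smul]⟩

theorem IsConv.add {w : ℕ} {f g : ℝ → ℂ} (hf : IsConv w f) (hg : IsConv w g) :
    IsConv w fun u => f u + g u := by
  obtain ⟨c, hc, h⟩ := hf
  obtain ⟨d, hd, h'⟩ := hg
  refine ⟨c + d, add_mem hc hd, fun u hu => ?_⟩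
  simp only [h u hu, h' u hu]
  exact (ps_add (polyGrowth_of_mem (convSpan_le _ hc)) (polyGrowth_of_mem (convSpan_le _ hd))
    (norm_ofReal_lt_one hu)).symm

theorem IsConv.const_mul (q : ℚ) {w : ℕ} {f : ℝ → ℂ} (hf : IsConv w f) :
    IsConv w fun u => (q : ℂ) * f u := by
  obtain ⟨c, hc, h⟩ := hf
  exact ⟨q • c, Submodule.smul_mem _ q hc, fun u hu => by simp only [h u hu, ps_rat_smul]⟩

theorem IsPoly.congr {w : ℕ} {f g : ℝ → ℂ} (hf : IsPoly w f)
    (h : ∀ u ∈ Set.Ico (0 : ℝ) 1, g u = f u) : IsPoly w g := by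
  obtain ⟨c, hc, h'⟩ := hf
  exact ⟨c, hc, fun u hu => (h u hu).trans (h' u hu)⟩

theorem IsConv.congr {w : ℕ} {f g : ℝ → ℂ} (hf : IsConv w f)
    (h : ∀ u ∈ Set.Ico (0 : ℝ) 1, g u = f u) : IsConv w g := by
  obtain ⟨c, hc, h'⟩ := hf
  exact ⟨c, hc, fun u hu => (h u hu).trans (h' u hu)⟩

theorem isPoly_zero_one : IsPoly 0 fun _ => 1 := by
  refine ⟨wordCoeff [], Submodule.subset_span ⟨[], by simp [IsWord], rfl, rfl⟩, fun u _ => ?_⟩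
  rw [ps, tsum_eq_single 0]
  · simp [wordCoeff]
  · intro n hn; simp [wordCoeff, hn]

section integration

variable {w : ℕ} {f F : ℝ → ℂ} {q₀ q₁ q₂ q₃ q₄ : ℚ}

theorem intForm_apply_zero (c : ℕ → ℂ) : intForm q₀ q₁ q₂ q₃ q₄ c 0 = 0 := by
  simp [intForm, intZero, intRoot]

theorem eqOn_ps_intForm {c : ℕ → ℂ} (hc : c ∈ polySpan w)
    (hf : ∀ u ∈ Set.Ico (0 : ℝ) 1, f u = ps c u) (h : 1 ≤ w ∨ q₀ = 0)
    (hF : ContinuousOn F (Set.Ico 0 1)) (h0 : F 0 = 0)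
    (hF' : ∀ u ∈ Set.Ioo (0 : ℝ) 1, HasDerivAt F (form q₀ q₁ q₂ q₃ q₄ u * f u) u) :
    ∀ u ∈ Set.Ico (0 : ℝ) 1, F u = ps (intForm q₀ q₁ q₂ q₃ q₄ c) u := by
  refine eqOn_of_hasDerivAt_eq hF
    (ps_ofReal_continuousOn (polyGrowth_of_mem (intForm_mem q₀ q₁ q₂ q₃ q₄ h hc))) ?_ hF' ?_
  · rw [h0, Complex.ofReal_zero, ps_zero_right, intForm_apply_zero]
  · intro u hu
    rw [hf u (Set.Ioo_subset_Ico_self hu)]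
    exact intForm_hasDerivAt q₀ q₁ q₂ q₃ q₄ h hc hu

theorem IsPoly.integrate (hf : IsPoly w f) (h : 1 ≤ w ∨ q₀ = 0)
    (hF : ContinuousOn F (Set.Ico 0 1)) (h0 : F 0 = 0)
    (hF' : ∀ u ∈ Set.Ioo (0 : ℝ) 1, HasDerivAt F (form q₀ q₁ q₂ q₃ q₄ u * f u) u) :
    IsPoly (w + 1) F := by
  obtain ⟨c, hc, hf⟩ := hf
  exact ⟨_, intForm_mem _ _ _ _ _ h hc, eqOn_ps_intForm hc hf h hF h0 hF'⟩

theorem IsPoly.integrate_conv (hf : IsPoly w f) (h : 1 ≤ w ∨ q₀ = 0)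
    (hF : ContinuousOn F (Set.Ico 0 1)) (h0 : F 0 = 0)
    (hF' : ∀ u ∈ Set.Ioo (0 : ℝ) 1, HasDerivAt F (form q₀ 0 q₂ q₃ q₄ u * f u) u) :
    IsConv (w + 1) F := by
  obtain ⟨c, hc, hf⟩ := hf
  exact ⟨_, intForm_mem_conv _ _ _ _ h hc, eqOn_ps_intForm hc hf h hF h0 hF'⟩

theorem IsPoly.exists_primitive (hf : IsPoly w f) (h : 1 ≤ w ∨ q₀ = 0) :
    ∃ F : ℝ → ℂ, IsConv (w + 1) F ∧ ContinuousOn F (Set.Ico 0 1) ∧ F 0 = 0 ∧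
      ∀ u ∈ Set.Ioo (0 : ℝ) 1, HasDerivAt F (form q₀ 0 q₂ q₃ q₄ u * f u) u := by
  obtain ⟨c, hc, hf⟩ := hf
  have hm := intForm_mem_conv q₀ q₂ q₃ q₄ h hc
  refine ⟨fun u => ps (intForm q₀ 0 q₂ q₃ q₄ c) u, ⟨_, hm, fun _ _ => rfl⟩,
    ps_ofReal_continuousOn (polyGrowth_of_mem (convSpan_le _ hm)), ?_, fun u hu => ?_⟩
  · simp only [Complex.ofReal_zero, ps_zero_right, intForm_apply_zero]
  · rw [hf u (Set.Ioo_subset_Ico_self hu)]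
    exact intForm_hasDerivAt q₀ 0 q₂ q₃ q₄ h hc hu

end integration

/-! ### Recurrence and size of the weights b_n. -/

theorem aperyB_zero : aperyB 0 = 1 := by simp [aperyB]

theorem aperyB_pos (n : ℕ) : 0 < aperyB n := by
  have := n.centralBinom_pos
  unfold aperyB
  positivity

theorem aperyB_succ (n : ℕ) : (2 * n + 1) * aperyB (n + 1) = (2 * n + 2) * aperyB n := by
  have h : ((n : ℝ) + 1) * ((n + 1).centralBinom : ℝ) = 2 * (2 * n + 1) * (n.centralBinom : ℝ) := by
    exact_mod_cast n.succ_mul_centralBinom_succ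
  have h1 : ((n + 1).centralBinom : ℝ) ≠ 0 := by exact_mod_cast (n + 1).centralBinom_ne_zero
  have h2 : (n.centralBinom : ℝ) ≠ 0 := by exact_mod_cast n.centralBinom_ne_zero
  rw [aperyB, aperyB, ← mul_div_assoc, ← mul_div_assoc, div_eq_div_iff h1 h2, pow_succ]
  linear_combination (-2) * 4 ^ n * h

theorem aperyB_sq_le (n : ℕ) : aperyB n ^ 2 ≤ 4 * n + 1 := by
  -- The bound `4 n` is sharp at `n = 1` and propagates upwards; only `b_0 = 1` forces the extra `+
  -- 1`.
  suffices h : ∀ n : ℕ, aperyB (n + 1) ^ 2 ≤ 4 * (n + 1) by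
    cases n with
    | zero => simp [aperyB_zero]
    | succ n => push_cast; linarith [h n]
  intro n
  induction n with
  | zero =>
    have := aperyB_succ 0
    rw [aperyB_zero] at this
    norm_num at this ⊢
    rw [this]; norm_num
  | succ n ih =>
    have h := aperyB_succ (n + 1)
    push_cast at h ⊢
    have hp : (0 : ℝ) < (2 * (n + 1) + 1) ^ 2 := by positivity
    refine le_of_mul_le_mul_left ?_ hp
    rw [← mul_pow, h, mul_pow]
    calc (2 * ((n : ℝ) + 1) + 2) ^ 2 * aperyB (n + 1) ^ 2
        ≤ (2 * ((n : ℝ) + 1) + 2) ^ 2 * (4 * (n + 1)) := by gcongr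
      _ ≤ _ := by nlinarith [(Nat.cast_nonneg n : (0 : ℝ) ≤ n)]

theorem polyGrowth_aperyB : PolyGrowth fun n => (aperyB n : ℂ) := by
  refine ⟨4, 1, by norm_num, fun n => ?_⟩
  have h := aperyB_sq_le n
  rw [Complex.norm_real, Real.norm_of_nonneg (aperyB_pos n).le, pow_one]
  have := (Nat.cast_nonneg n : (0 : ℝ) ≤ n)
  nlinarith [aperyB_pos n]

/-! ### The substitution u = tan (t / 2). -/

/-- `sin t`, where `u = tan (t / 2)`. -/
noncomputable def sinU (u : ℝ) : ℝ := 2 * u / (1 + u ^ 2)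

/-- `cos t`, where `u = tan (t / 2)`. -/
noncomputable def cosU (u : ℝ) : ℝ := (1 - u ^ 2) / (1 + u ^ 2)

/-- `dt / du`, where `u = tan (t / 2)`. -/
noncomputable def dthetaU (u : ℝ) : ℝ := 2 / (1 + u ^ 2)

theorem sinU_sq_add_cosU_sq (u : ℝ) : sinU u ^ 2 + cosU u ^ 2 = 1 := by
  have : 1 + u ^ 2 ≠ 0 := by positivity
  unfold sinU cosU
  field_simp
  ring

theorem hasDerivAt_sinU (u : ℝ) : HasDerivAt sinU (cosU u * dthetaU u) u := by
  have h0 : 1 + u ^ 2 ≠ 0 := by positivity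
  refine (((hasDerivAt_id u).const_mul 2).div ((hasDerivAt_pow 2 u).const_add 1) h0).congr_deriv ?_
  unfold cosU dthetaU
  simp only [id]
  field_simp
  push_cast
  ring

theorem hasDerivAt_cosU (u : ℝ) : HasDerivAt cosU (-(sinU u * dthetaU u)) u := by
  have h0 : 1 + u ^ 2 ≠ 0 := by positivity
  refine (((hasDerivAt_pow 2 u).const_sub 1).div ((hasDerivAt_pow 2 u).const_add 1)
    h0).congr_deriv ?_
  unfold sinU dthetaU
  field_simp
  push_cast
  ring

theorem sinU_zero : sinU 0 = 0 := by simp [sinU]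

theorem sinU_nonneg {u : ℝ} (hu : 0 ≤ u) : 0 ≤ sinU u := by unfold sinU; positivity

theorem sinU_pos {u : ℝ} (hu : 0 < u) : 0 < sinU u := by unfold sinU; positivity

theorem cosU_pos {u : ℝ} (hu : u ∈ Set.Ico (0 : ℝ) 1) : 0 < cosU u := by
  have : u ^ 2 < 1 := pow_lt_one₀ hu.1 hu.2 (by norm_num)
  unfold cosU
  exact div_pos (by linarith) (by positivity)

theorem sinU_lt_one {u : ℝ} (hu : u ∈ Set.Ico (0 : ℝ) 1) : sinU u < 1 := by
  have h1 := sinU_sq_add_cosU_sq u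
  have h2 := cosU_pos hu
  nlinarith [sinU_nonneg hu.1]

theorem sinU_sq_mem {u : ℝ} (hu : u ∈ Set.Ico (0 : ℝ) 1) : sinU u ^ 2 ∈ Set.Ico (0 : ℝ) 1 :=
  ⟨by positivity, pow_lt_one₀ (sinU_nonneg hu.1) (sinU_lt_one hu) (by norm_num)⟩

theorem norm_sinU_sq_lt_one {u : ℝ} (hu : u ∈ Set.Ico (0 : ℝ) 1) : ‖(sinU u : ℂ) ^ 2‖ < 1 := by
  rw [← Complex.ofReal_pow]
  exact norm_ofReal_lt_one (sinU_sq_mem hu)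

/-- A power series in `sin² t`, as a function of `u`. -/
noncomputable def psSin (a : ℕ → ℂ) (u : ℝ) : ℂ := ps a ((sinU u : ℂ) ^ 2)

theorem psSin_zero (a : ℕ → ℂ) : psSin a 0 = a 0 := by
  simp [psSin, sinU_zero, ps_zero_right]

theorem psSin_hasDerivAt {a : ℕ → ℂ} (ha : PolyGrowth a) {u : ℝ} (hu : u ∈ Set.Ico (0 : ℝ) 1) :
    HasDerivAt (psSin a) (psSin (fun n => ((n : ℂ) + 1) * a (n + 1)) u *
      (2 * sinU u * (cosU u * dthetaU u))) u := by
  have h := ((hasDerivAt_sinU u).pow 2).ofReal_comp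
  have h1 : HasDerivAt (fun u : ℝ => (sinU u : ℂ) ^ 2) (2 * sinU u * (cosU u * dthetaU u)) u := by
    simpa using h
  exact (ps_hasDerivAt ha (norm_sinU_sq_lt_one hu)).comp u h1

theorem psSin_continuousOn {a : ℕ → ℂ} (ha : PolyGrowth a) :
    ContinuousOn (psSin a) (Set.Ico 0 1) := fun _ hu =>
  (psSin_hasDerivAt ha hu).continuousAt.continuousWithinAt

theorem sinU_continuous : Continuous fun u : ℝ => (sinU u : ℂ) :=
  Complex.continuous_ofReal.comp
    (continuous_iff_continuousAt.2 fun u => (hasDerivAt_sinU u).continuousAt)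

theorem cosU_continuous : Continuous fun u : ℝ => (cosU u : ℂ) :=
  Complex.continuous_ofReal.comp
    (continuous_iff_continuousAt.2 fun u => (hasDerivAt_cosU u).continuousAt)

theorem hasDerivAt_sinU_complex (u : ℝ) :
    HasDerivAt (fun u : ℝ => (sinU u : ℂ)) (cosU u * dthetaU u) u := by
  simpa using (hasDerivAt_sinU u).ofReal_comp

theorem hasDerivAt_cosU_complex (u : ℝ) :
    HasDerivAt (fun u : ℝ => (cosU u : ℂ)) (-(sinU u * dthetaU u)) u := by
  simpa using (hasDerivAt_cosU u).ofReal_comp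

theorem one_add_sq_ne_zero (u : ℝ) : (1 : ℂ) + (u : ℂ) ^ 2 ≠ 0 := by
  have : 1 + u ^ 2 ≠ 0 := by positivity
  exact_mod_cast this

/-- Over the common real denominator, the two conjugate forms have sum `-2u / (1 + u ^ 2)` and
difference `2i / (1 + u ^ 2)`. -/
theorem form_I (u : ℝ) : Complex.I / (1 - Complex.I * u) = (Complex.I - u) / (1 + u ^ 2) := by
  have h : (1 + (u : ℂ) ^ 2) = (1 - Complex.I * u) * (1 + Complex.I * u) := by
    linear_combination (u : ℂ) ^ 2 * Complex.I_sq
  have h0 := one_add_sq_ne_zero u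
  have h1 : 1 - Complex.I * u ≠ 0 := fun h' => h0 (by rw [h, h', zero_mul])
  rw [div_eq_div_iff h1 h0]
  linear_combination (u : ℂ) * Complex.I_sq

theorem form_neg_I (u : ℝ) :
    -Complex.I / (1 + Complex.I * u) = (-Complex.I - u) / (1 + u ^ 2) := by
  have h : (1 + (u : ℂ) ^ 2) = (1 - Complex.I * u) * (1 + Complex.I * u) := by
    linear_combination (u : ℂ) ^ 2 * Complex.I_sq
  have h0 := one_add_sq_ne_zero u
  have h1 : 1 + Complex.I * u ≠ 0 := fun h' => h0 (by rw [h, h', mul_zero])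
  rw [div_eq_div_iff h1 h0]
  linear_combination (u : ℂ) * Complex.I_sq

section forms

variable {u : ℝ} (hu : u ∈ Set.Ioo (0 : ℝ) 1)

/-- Rational coefficients are available for `i dt` but not for `dt`; this is why `i` accompanies
`primSeries` and `oddSeries` throughout. -/
theorem form_dtheta : form 0 0 0 1 (-1) u = Complex.I * dthetaU u := by
  have h0 := one_add_sq_ne_zero u
  rw [form, form_I, form_neg_I, dthetaU]
  push_cast
  field_simp
  ring

theorem form_neg_dtheta : form 0 0 0 (-1) 1 u = -(Complex.I * dthetaU u) := by
  have h0 := one_add_sq_ne_zero u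
  rw [form, form_I, form_neg_I, dthetaU]
  push_cast
  field_simp
  ring

include hu

theorem ofReal_ne_zero_of_mem : (u : ℂ) ≠ 0 := by exact_mod_cast hu.1.ne'

theorem one_sub_ne_zero_of_mem : 1 - (u : ℂ) ≠ 0 := by
  have : 1 - u ≠ 0 := (sub_pos.2 hu.2).ne'
  exact_mod_cast this

theorem one_add_ne_zero_of_mem : 1 + (u : ℂ) ≠ 0 := by
  have : 1 + u ≠ 0 := by linarith [hu.1]
  exact_mod_cast this

theorem form_csc : form 1 0 0 0 0 u = dthetaU u / sinU u := by
  have h0 := one_add_sq_ne_zero u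
  have h1 := ofReal_ne_zero_of_mem hu
  rw [form, form_I, form_neg_I, dthetaU, sinU]
  push_cast
  field_simp
  ring

theorem form_cot : form 1 0 0 1 1 u = cosU u * dthetaU u / sinU u := by
  have h0 := one_add_sq_ne_zero u
  have h1 := ofReal_ne_zero_of_mem hu
  rw [form, form_I, form_neg_I, dthetaU, sinU, cosU]
  push_cast
  field_simp
  ring

theorem form_tan : form 0 1 1 (-1) (-1) u = sinU u * dthetaU u / cosU u := by
  have h0 := one_add_sq_ne_zero u
  have h2 := one_sub_ne_zero_of_mem hu
  have h3 := one_add_ne_zero_of_mem hu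
  have h4 : 1 - (u : ℂ) ^ 2 = (1 - u) * (1 + u) := by ring
  rw [form, form_I, form_neg_I, dthetaU, sinU, cosU]
  push_cast
  rw [h4]
  field_simp
  ring

theorem form_csc_sec : form 1 1 1 0 0 u = dthetaU u / (sinU u * cosU u) := by
  have h0 := one_add_sq_ne_zero u
  have h1 := ofReal_ne_zero_of_mem hu
  have h2 := one_sub_ne_zero_of_mem hu
  have h3 := one_add_ne_zero_of_mem hu
  have h4 : 1 - (u : ℂ) ^ 2 = (1 - u) * (1 + u) := by ring
  rw [form, form_I, form_neg_I, dthetaU, sinU, cosU]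
  push_cast
  rw [h4]
  field_simp
  ring

end forms

/-! ### Generating series in sin t and their differential equations. -/

/-- `cos t` times the sum of `b_n C_{n+1} sin^{2n+1} t / (2n+1)`, as a function of `u`. -/
noncomputable def primSeries (C : ℕ → ℂ) (u : ℝ) : ℂ :=
  cosU u * (sinU u * psSin (fun n => aperyB n * C (n + 1) / ((2 * n + 1 : ℕ) : ℂ) ^ 1) u)

/-- The sum of `b_n D_n sin^{2n} t / (2n)^s`, as a function of `u`. -/
noncomputable def evenSeries (s : ℕ) (D : ℕ → ℂ) : ℝ → ℂ :=
  psSin fun n => aperyB n * D n / ((2 * n : ℕ) : ℂ) ^ s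

/-- The sum of `b_n D_n sin^{2n+1} t / (2n+1)^s`, as a function of `u`. -/
noncomputable def oddSeries (s : ℕ) (D : ℕ → ℂ) (u : ℝ) : ℂ :=
  sinU u * psSin (fun n => aperyB n * D n / ((2 * n + 1 : ℕ) : ℂ) ^ s) u

theorem polyGrowth_even {D : ℕ → ℂ} (hD : PolyGrowth D) (s : ℕ) :
    PolyGrowth fun n => aperyB n * D n / ((2 * n : ℕ) : ℂ) ^ s :=
  (polyGrowth_aperyB.mul hD).div_pow s

theorem polyGrowth_odd {D : ℕ → ℂ} (hD : PolyGrowth D) (s : ℕ) :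
    PolyGrowth fun n => aperyB n * D n / ((2 * n + 1 : ℕ) : ℂ) ^ s :=
  (polyGrowth_aperyB.mul hD).div_pow s

theorem aperyB_succ_complex (n : ℕ) :
    (2 * (n : ℂ) + 1) * aperyB (n + 1) = (2 * n + 2) * aperyB n := by
  exact_mod_cast congrArg (fun x : ℝ => (x : ℂ)) (aperyB_succ n)

theorem two_mul_add_one_ne (n : ℕ) : 2 * (n : ℂ) + 1 ≠ 0 := by
  exact_mod_cast Nat.succ_ne_zero (2 * n)

theorem two_mul_add_two_ne (n : ℕ) : 2 * (n : ℂ) + 2 ≠ 0 := by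
  exact_mod_cast Nat.succ_ne_zero (2 * n + 1)

theorem primSeries_continuousOn {C : ℕ → ℂ} (hC : PolyGrowth C) :
    ContinuousOn (primSeries C) (Set.Ico 0 1) :=
  cosU_continuous.continuousOn.mul
    (sinU_continuous.continuousOn.mul (psSin_continuousOn (polyGrowth_odd hC.shift 1)))

theorem primSeries_zero (C : ℕ → ℂ) : primSeries C 0 = 0 := by
  simp [primSeries, sinU_zero]

/-- The differential equation which removes one layer of a nested sum. -/
theorem primSeries_hasDerivAt {c : ℕ → ℂ} (hc : PolyGrowth c) {u : ℝ}
    (hu : u ∈ Set.Ico (0 : ℝ) 1) :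
    HasDerivAt (primSeries fun n => ∑ m ∈ range n, c m)
      (dthetaU u * psSin (fun n => aperyB n * c n) u) u := by
  set C : ℕ → ℂ := fun n => ∑ m ∈ range n, c m with hCdef
  have hC : PolyGrowth C := hc.sum_range
  set β : ℕ → ℂ := fun n => aperyB n * C (n + 1) / ((2 * n + 1 : ℕ) : ℂ) ^ 1 with hβdef
  have hβ : PolyGrowth β := polyGrowth_odd hC.shift 1
  have hz := norm_sinU_sq_lt_one hu
  have hbc : PolyGrowth fun n => aperyB n * c n := polyGrowth_aperyB.mul hc
  have hbC : PolyGrowth fun n => aperyB n * C n := polyGrowth_aperyB.mul hC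
  have hnβ : PolyGrowth fun n => (n : ℂ) * β n := by
    have := (PolyGrowth.natCast_add_one.mul hβ).sub hβ
    simpa [add_mul] using this
  have hT := mul_ps_deriv hβ hz
  -- Differentiating gives `-sin t` times the odd series plus `cos² t ∑ b_n C_{n+1} sin^{2n} t`.
  -- After `cos² = 1 - sin²` the coefficient of `-sin^{2n+2} t` is `b_n C_{n+1} (1 + 1/(2n+1)) =
  -- b_{n+1} C_{n+1}`. What survives is `b_n (C_{n+1} - C_n) = b_n c_n`, since `C_0 = 0`.
  have e1 : ps (fun n => aperyB n * C (n + 1)) ((sinU u : ℂ) ^ 2)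
      = ps β ((sinU u : ℂ) ^ 2) + 2 * ps (fun n => (n : ℂ) * β n) ((sinU u : ℂ) ^ 2) := by
    rw [← ps_const_mul, ← ps_add hβ (hnβ.const_mul 2) hz]
    congr 1
    ext n
    have := two_mul_add_one_ne n
    simp only [hβdef]
    push_cast
    field_simp
    ring
  have e2 : ps (fun n => aperyB (n + 1) * C (n + 1)) ((sinU u : ℂ) ^ 2)
      = 2 * ps β ((sinU u : ℂ) ^ 2) + 2 * ps (fun n => (n : ℂ) * β n) ((sinU u : ℂ) ^ 2) := by
    rw [← ps_const_mul, ← ps_const_mul, ← ps_add (hβ.const_mul 2) (hnβ.const_mul 2) hz]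
    congr 1
    ext n
    have := two_mul_add_one_ne n
    have h := aperyB_succ_complex n
    simp only [hβdef]
    push_cast
    field_simp
    linear_combination C (n + 1) * h
  have e3 : ps (fun n => aperyB n * C (n + 1)) ((sinU u : ℂ) ^ 2)
      = ps (fun n => aperyB n * C n) ((sinU u : ℂ) ^ 2)
        + ps (fun n => aperyB n * c n) ((sinU u : ℂ) ^ 2) := by
    rw [← ps_add hbC hbc hz]
    congr 1
    ext n
    simp only [hCdef, sum_range_succ]
    ring
  have e4 := ps_eq_head_add hbC hz
  have hC0 : C 0 = 0 := by simp [hCdef]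
  rw [hC0, mul_zero, zero_add] at e4
  have hd := (hasDerivAt_cosU_complex u).mul
    ((hasDerivAt_sinU_complex u).mul (psSin_hasDerivAt hβ hu))
  refine hd.congr_deriv ?_
  have hsc : (sinU u : ℂ) ^ 2 + (cosU u : ℂ) ^ 2 = 1 := by exact_mod_cast sinU_sq_add_cosU_sq u
  simp only [psSin, Pi.mul_apply] at *
  linear_combination (dthetaU u : ℂ) * (2 * (cosU u : ℂ) ^ 2 * hT
    + (ps β ((sinU u : ℂ) ^ 2) + 2 * ps (fun n => (n : ℂ) * β n) ((sinU u : ℂ) ^ 2)) * hsc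
    - e1 + (sinU u : ℂ) ^ 2 * e2 + e3 + e4)

/-- The identity `b_{n+1} / (2n+2) = b_n / (2n+1)` shifts the even series into the odd one. The term
`n = 0` vanishes because division by zero gives zero. -/
theorem evenSeries_one {C : ℕ → ℂ} (hC : PolyGrowth C) {u : ℝ} (hu : u ∈ Set.Ico (0 : ℝ) 1) :
    evenSeries 1 C u = sinU u / cosU u * primSeries C u := by
  have hcos : (cosU u : ℂ) ≠ 0 := by exact_mod_cast (cosU_pos hu).ne'
  rw [evenSeries, psSin, ps_eq_head_add (polyGrowth_even hC 1) (norm_sinU_sq_lt_one hu), primSeries,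
    psSin]
  have : (fun n : ℕ => aperyB (n + 1) * C (n + 1) / ((2 * (n + 1) : ℕ) : ℂ) ^ 1)
      = fun n : ℕ => aperyB n * C (n + 1) / ((2 * n + 1 : ℕ) : ℂ) ^ 1 := by
    ext n
    have h1 := two_mul_add_one_ne n
    have h2 := two_mul_add_two_ne n
    have h := aperyB_succ_complex n
    push_cast
    rw [pow_one, pow_one, div_eq_div_iff (by rwa [mul_add, mul_one]) h1]
    linear_combination C (n + 1) * h
  rw [this]
  field_simp
  simp

theorem oddSeries_one (C : ℕ → ℂ) {u : ℝ} (hu : u ∈ Set.Ico (0 : ℝ) 1) :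
    oddSeries 1 (fun n => C (n + 1)) u = primSeries C u / cosU u := by
  have hcos : (cosU u : ℂ) ≠ 0 := by exact_mod_cast (cosU_pos hu).ne'
  rw [oddSeries, primSeries, mul_div_cancel_left₀ _ hcos]

/-- Differentiation multiplies `sin^{2n} t` by `2n cot t`. With `1 ≤ s` the term `n = 0` is zero on
both sides. -/
theorem evenSeries_hasDerivAt {D : ℕ → ℂ} (hD : PolyGrowth D) {s : ℕ} (hs : 1 ≤ s) {u : ℝ}
    (hu : u ∈ Set.Ioo (0 : ℝ) 1) :
    HasDerivAt (evenSeries (s + 1) D) (cosU u * dthetaU u / sinU u * evenSeries s D u) u := by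
  have hu' := Set.Ioo_subset_Ico_self hu
  have hsin : (sinU u : ℂ) ≠ 0 := by exact_mod_cast (sinU_pos hu.1).ne'
  have hg := polyGrowth_even hD (s + 1)
  refine (psSin_hasDerivAt hg hu').congr_deriv ?_
  have hT := mul_ps_deriv hg (norm_sinU_sq_lt_one hu')
  have e : evenSeries s D u = 2 * ps (fun n : ℕ => (n : ℂ) *
      (aperyB n * D n / ((2 * n : ℕ) : ℂ) ^ (s + 1))) ((sinU u : ℂ) ^ 2) := by
    rw [← ps_const_mul, evenSeries, psSin]
    congr 1
    ext n
    rcases Nat.eq_zero_or_pos n with rfl | hn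
    · have : s ≠ 0 := by omega
      simp [this]
    · have : (n : ℂ) ≠ 0 := by exact_mod_cast hn.ne'
      push_cast
      rw [pow_succ]
      field_simp
  rw [e, ← hT, psSin]
  field_simp

theorem oddSeries_hasDerivAt {D : ℕ → ℂ} (hD : PolyGrowth D) (s : ℕ) {u : ℝ}
    (hu : u ∈ Set.Ioo (0 : ℝ) 1) :
    HasDerivAt (oddSeries (s + 1) D) (cosU u * dthetaU u / sinU u * oddSeries s D u) u := by
  have hu' := Set.Ioo_subset_Ico_self hu
  have hz := norm_sinU_sq_lt_one hu'
  have hsin : (sinU u : ℂ) ≠ 0 := by exact_mod_cast (sinU_pos hu.1).ne'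
  have hg := polyGrowth_odd hD (s + 1)
  refine ((hasDerivAt_sinU_complex u).mul (psSin_hasDerivAt hg hu')).congr_deriv ?_
  have hT := mul_ps_deriv hg hz
  have hng : PolyGrowth fun n => (n : ℂ) * (aperyB n * D n / ((2 * n + 1 : ℕ) : ℂ) ^ (s + 1)) := by
    have := (PolyGrowth.natCast_add_one.mul hg).sub hg
    simpa [add_mul] using this
  have e : psSin (fun n => aperyB n * D n / ((2 * n + 1 : ℕ) : ℂ) ^ s) u
      = psSin (fun n => aperyB n * D n / ((2 * n + 1 : ℕ) : ℂ) ^ (s + 1)) u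
      + 2 * ps (fun n : ℕ => (n : ℂ) *
      (aperyB n * D n / ((2 * n + 1 : ℕ) : ℂ) ^ (s + 1))) ((sinU u : ℂ) ^ 2) := by
    rw [← ps_const_mul, psSin, psSin, ← ps_add hg (hng.const_mul 2) hz]
    congr 1
    ext n
    have := two_mul_add_one_ne n
    push_cast
    rw [pow_succ]
    field_simp
    ring
  rw [oddSeries, e, ← hT, psSin, psSin]
  field_simp

theorem evenSeries_continuousOn {D : ℕ → ℂ} (hD : PolyGrowth D) (s : ℕ) :
    ContinuousOn (evenSeries s D) (Set.Ico 0 1) := psSin_continuousOn (polyGrowth_even hD s)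

theorem oddSeries_continuousOn {D : ℕ → ℂ} (hD : PolyGrowth D) (s : ℕ) :
    ContinuousOn (oddSeries s D) (Set.Ico 0 1) :=
  sinU_continuous.continuousOn.mul (psSin_continuousOn (polyGrowth_odd hD s))

theorem evenSeries_zero (D : ℕ → ℂ) {s : ℕ} (hs : 1 ≤ s) : evenSeries s D 0 = 0 := by
  have : s ≠ 0 := by omega
  simp [evenSeries, psSin_zero, this]

theorem oddSeries_zero (D : ℕ → ℂ) (s : ℕ) : oddSeries s D 0 = 0 := by
  simp [oddSeries, sinU_zero]

/-! ### Prepending a summation to a nested sum. -/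

/-- The series attached to `C` is `i` times a combination of polylogarithms of weight `w + 1`. -/
def Good (w : ℕ) (C : ℕ → ℂ) : Prop :=
  PolyGrowth C ∧ IsPoly (w + 1) fun u => Complex.I * primSeries C u

section good

variable {w : ℕ} {C : ℕ → ℂ}

/-- For exponent 1 the series is `tan t` times `primSeries`; the next form `cot t dt` cancels the
tangent and with it the pole at `u = 1`. The factors `-i dt` and `i` multiply to `dt`. -/
theorem Good.evenSeries (h : Good w C) {s : ℕ} (hs : 2 ≤ s) : IsConv (w + s) (evenSeries s C) := by
  obtain ⟨hC, hP⟩ := h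
  induction s, hs using Nat.le_induction with
  | base =>
    refine hP.integrate_conv (q₀ := 0) (q₂ := 0) (q₃ := -1) (q₄ := 1) (Or.inr rfl)
      (evenSeries_continuousOn hC 2) (evenSeries_zero C (by norm_num)) fun u hu => ?_
    have hu' := Set.Ioo_subset_Ico_self hu
    refine (evenSeries_hasDerivAt hC le_rfl hu).congr_deriv ?_
    have hsin : (sinU u : ℂ) ≠ 0 := by exact_mod_cast (sinU_pos hu.1).ne'
    have hcos : (cosU u : ℂ) ≠ 0 := by exact_mod_cast (cosU_pos hu').ne'
    rw [form_neg_dtheta, evenSeries_one hC hu']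
    field_simp
    linear_combination ((dthetaU u : ℂ) * primSeries C u) * Complex.I_sq
  | succ s hs ih =>
    refine ih.isPoly.integrate_conv (q₀ := 1) (q₂ := 0) (q₃ := 1) (q₄ := 1)
      (Or.inl (by omega : 1 ≤ w + s))
      (evenSeries_continuousOn hC _) (evenSeries_zero C (by omega)) fun u hu => ?_
    rw [form_cot hu]
    exact evenSeries_hasDerivAt hC (by omega) hu

/-- The factor `1 / cos t` of exponent 1 is cancelled by `cot t dt`, which leaves `dt / sin t = du /
u`. -/
theorem Good.oddSeries (h : Good w C) {s : ℕ} (hs : 2 ≤ s) :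
    IsConv (w + s) fun u => Complex.I * oddSeries s (fun n => C (n + 1)) u := by
  obtain ⟨hC, hP⟩ := h
  induction s, hs using Nat.le_induction with
  | base =>
    refine hP.integrate_conv (q₀ := 1) (q₂ := 0) (q₃ := 0) (q₄ := 0) (Or.inl (by omega))
      (continuousOn_const.mul (oddSeries_continuousOn hC.shift 2)) (by simp [oddSeries_zero])
      fun u hu => ?_
    have hu' := Set.Ioo_subset_Ico_self hu
    refine ((oddSeries_hasDerivAt hC.shift 1 hu).const_mul Complex.I).congr_deriv ?_
    have hsin : (sinU u : ℂ) ≠ 0 := by exact_mod_cast (sinU_pos hu.1).ne'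
    have hcos : (cosU u : ℂ) ≠ 0 := by exact_mod_cast (cosU_pos hu').ne'
    rw [form_csc hu, oddSeries_one C hu']
    field_simp
  | succ s hs ih =>
    refine ih.isPoly.integrate_conv (q₀ := 1) (q₂ := 0) (q₃ := 1) (q₄ := 1)
      (Or.inl (by omega : 1 ≤ w + s))
      (continuousOn_const.mul (oddSeries_continuousOn hC.shift _)) (by simp [oddSeries_zero])
      fun u hu => ?_
    rw [form_cot hu]
    refine ((oddSeries_hasDerivAt hC.shift s hu).const_mul Complex.I).congr_deriv ?_
    ring

/-- `primSeries` reads its sequence at positive indices only. -/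
theorem Good.congr {D : ℕ → ℂ} (h : Good w C) (hD : ∀ n, 1 ≤ n → D n = C n)
    (hg : PolyGrowth D) : Good w D := by
  refine ⟨hg, h.2.congr fun u _ => ?_⟩
  simp only [primSeries, hD _ (Nat.le_add_left 1 _)]

theorem primSeries_add {D : ℕ → ℂ} (hC : PolyGrowth C) (hD : PolyGrowth D) {u : ℝ}
    (hu : u ∈ Set.Ico (0 : ℝ) 1) :
    primSeries (fun n => C n + D n) u = primSeries C u + primSeries D u := by
  simp only [primSeries, psSin]
  rw [← mul_add, ← mul_add, ← ps_add (polyGrowth_odd hC.shift 1) (polyGrowth_odd hD.shift 1)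
    (norm_sinU_sq_lt_one hu)]
  simp only [mul_add, add_div]

theorem Good.add {D : ℕ → ℂ} (hC : Good w C) (hD : Good w D) : Good w fun n => C n + D n := by
  refine ⟨hC.1.add hD.1, (hC.2.add hD.2).congr fun u hu => ?_⟩
  rw [primSeries_add hC.1 hD.1 hu, mul_add]

theorem Good.const_mul (q : ℚ) (hC : Good w C) : Good w fun n => (q : ℂ) * C n := by
  refine ⟨hC.1.const_mul _, (hC.2.const_mul q).congr fun u hu => ?_⟩
  have : (fun n : ℕ => aperyB n * ((q : ℂ) * C (n + 1)) / ((2 * n + 1 : ℕ) : ℂ) ^ 1)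
      = fun n : ℕ => (q : ℂ) * (aperyB n * C (n + 1) / ((2 * n + 1 : ℕ) : ℂ) ^ 1) := by
    ext n; ring
  simp only [primSeries, psSin]
  rw [this, ps_const_mul]
  ring

/-- At positive indices the constant 1 is the partial sum of the sequence supported at 0, so that
`primSeries` is `t` itself. -/
theorem good_one : Good 0 fun _ => 1 := by
  have hc : PolyGrowth fun n : ℕ => if n = 0 then (1 : ℂ) else 0 :=
    PolyGrowth.of_bounded 1 fun n => by split_ifs <;> simp
  refine Good.congr (C := fun n => ∑ m ∈ range n, if m = 0 then (1 : ℂ) else 0) ⟨hc.sum_range, ?_⟩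
    (fun n hn => by
      have : n ≠ 0 := by omega
      simp [this]) (PolyGrowth.const 1)
  refine isPoly_zero_one.integrate (q₀ := 0) (q₁ := 0) (q₂ := 0) (q₃ := 1) (q₄ := -1) (Or.inr rfl)
    (continuousOn_const.mul (primSeries_continuousOn hc.sum_range)) (by simp [primSeries_zero])
    fun u hu => ?_
  refine ((primSeries_hasDerivAt hc (Set.Ioo_subset_Ico_self hu)).const_mul
    Complex.I).congr_deriv ?_
  have : psSin (fun n => aperyB n * if n = 0 then (1 : ℂ) else 0) u = 1 := by
    rw [psSin, ps, tsum_eq_single 0]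
    · simp [aperyB_zero]
    · intro n hn; simp [hn]
  rw [this, form_dtheta, mul_one, mul_one]

/-- The derivative of the new `primSeries` is the even series of the inner sum. For `s = 1` the form
`tan t dt` keeps its pole at `u = 1`, which is harmless in an inner layer. The summand `m = 0` is
zero by division by zero. -/
theorem Good.even_step (h : Good w C) {s : ℕ} (hs : 1 ≤ s) :
    Good (w + s) fun n => ∑ m ∈ range n, C m / ((2 * m : ℕ) : ℂ) ^ s := by
  have hc : PolyGrowth fun m => C m / ((2 * m : ℕ) : ℂ) ^ s := h.1.div_pow s
  have hd : ∀ u ∈ Set.Ioo (0 : ℝ) 1, HasDerivAt (fun u => Complex.I *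
      primSeries (fun n => ∑ m ∈ range n, C m / ((2 * m : ℕ) : ℂ) ^ s) u)
      (Complex.I * dthetaU u * AperySeries.evenSeries s C u) u := fun u hu => by
    refine ((primSeries_hasDerivAt hc (Set.Ioo_subset_Ico_self hu)).const_mul
      Complex.I).congr_deriv ?_
    simp only [AperySeries.evenSeries, mul_div_assoc, mul_assoc]
  have hcont := continuousOn_const (c := Complex.I).mul (primSeries_continuousOn hc.sum_range)
  refine ⟨hc.sum_range, ?_⟩
  rcases hs.eq_or_lt with rfl | hs
  · refine h.2.integrate (q₀ := 0) (q₁ := 1) (q₂ := 1) (q₃ := -1) (q₄ := -1) (Or.inr rfl)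
      hcont (by simp [primSeries_zero]) fun u hu => (hd u hu).congr_deriv ?_
    rw [form_tan hu, evenSeries_one h.1 (Set.Ioo_subset_Ico_self hu)]
    ring
  · refine (h.evenSeries hs).isPoly.integrate (q₀ := 0) (q₁ := 0) (q₂ := 0) (q₃ := 1) (q₄ := -1)
      (Or.inr rfl) hcont (by simp [primSeries_zero]) fun u hu => ?_
    rw [form_dtheta]
    exact hd u hu

/-- The engine yields even powers of the sine, so an odd series enters divided by `sin t`: this
gives `dt / sin t`, or `dt / (sin t cos t)` when `s = 1`. -/
theorem Good.odd_step (h : Good w C) {s : ℕ} (hs : 1 ≤ s) :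
    Good (w + s) fun n => ∑ m ∈ range n, C (m + 1) / ((2 * m + 1 : ℕ) : ℂ) ^ s := by
  have hc : PolyGrowth fun m => C (m + 1) / ((2 * m + 1 : ℕ) : ℂ) ^ s :=
    h.1.shift.div_pow s
  have hd : ∀ u ∈ Set.Ioo (0 : ℝ) 1, HasDerivAt (fun u => Complex.I *
      primSeries (fun n => ∑ m ∈ range n, C (m + 1) / ((2 * m + 1 : ℕ) : ℂ) ^ s) u)
      (dthetaU u / sinU u * (Complex.I * AperySeries.oddSeries s (fun n => C (n + 1)) u)) u :=
    fun u hu => by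
    refine ((primSeries_hasDerivAt hc (Set.Ioo_subset_Ico_self hu)).const_mul
      Complex.I).congr_deriv ?_
    have hsin : (sinU u : ℂ) ≠ 0 := by exact_mod_cast (sinU_pos hu.1).ne'
    simp only [AperySeries.oddSeries, mul_div_assoc]
    field_simp
  have hcont := continuousOn_const (c := Complex.I).mul (primSeries_continuousOn hc.sum_range)
  refine ⟨hc.sum_range, ?_⟩
  rcases hs.eq_or_lt with rfl | hs
  · refine h.2.integrate (q₀ := 1) (q₁ := 1) (q₂ := 1) (q₃ := 0) (q₄ := 0) (Or.inl (by omega))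
      hcont (by simp [primSeries_zero]) fun u hu => (hd u hu).congr_deriv ?_
    rw [form_csc_sec hu, oddSeries_one C (Set.Ioo_subset_Ico_self hu)]
    have hsin : (sinU u : ℂ) ≠ 0 := by exact_mod_cast (sinU_pos hu.1).ne'
    have hcos : (cosU u : ℂ) ≠ 0 := by
      exact_mod_cast (cosU_pos (Set.Ioo_subset_Ico_self hu)).ne'
    field_simp
  · refine (h.oddSeries hs).isPoly.integrate (q₀ := 1) (q₁ := 0) (q₂ := 0) (q₃ := 0) (q₄ := 0)
      (Or.inl (by omega)) hcont (by simp [primSeries_zero]) fun u hu => ?_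
    rw [form_csc hu]
    exact hd u hu

end good

/-! ### Truncated zeta and t-sums, decomposed by their largest index. -/

theorem zetaTrunc_cons_zero (k : ℕ) (ks : List ℕ) : zetaTrunc (k :: ks) 0 = 0 := by
  simp [zetaTrunc]

theorem tTrunc_cons_zero (l : ℕ) (ls : List ℕ) : tTrunc (l :: ls) 0 = 0 := by
  simp [tTrunc]

theorem zetaTrunc_cons_succ (k : ℕ) (ks : List ℕ) (n : ℕ) :
    zetaTrunc (k :: ks) (n + 1)
      = zetaTrunc (k :: ks) n + 1 / ((n : ℝ) + 1) ^ k * zetaTrunc ks n := by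
  rw [zetaTrunc, zetaTrunc, sum_Icc_succ_top (by omega)]
  push_cast
  rfl

theorem tTrunc_cons_succ (l : ℕ) (ls : List ℕ) (n : ℕ) :
    tTrunc (l :: ls) (n + 1)
      = tTrunc (l :: ls) n + 1 / (2 * (n : ℝ) + 1) ^ l * tTrunc ls n := by
  rw [tTrunc, tTrunc, sum_Icc_succ_top (by omega)]
  push_cast
  rw [show 2 * ((n : ℝ) + 1) - 1 = 2 * n + 1 by ring]

theorem zetaTrunc_bounds {k : List ℕ} (hk : ∀ x ∈ k, 0 < x) (n : ℕ) :
    0 ≤ zetaTrunc k n ∧ zetaTrunc k n ≤ (harmonic n : ℝ) ^ k.length := by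
  induction k generalizing n with
  | nil => simp [zetaTrunc]
  | cons x ks ih =>
    have ih := ih fun y hy => hk y (by simp [hy])
    refine ⟨sum_nonneg fun m _ => mul_nonneg (by positivity) (ih _).1, ?_⟩
    rw [zetaTrunc, List.length_cons, pow_succ']
    nth_rewrite 1 [harmonic_eq_sum_Icc]
    rw [Rat.cast_sum, sum_mul]
    refine sum_le_sum fun m hm => ?_
    obtain ⟨h1, h2⟩ := mem_Icc.1 hm
    have hm1 : (1 : ℝ) ≤ m := by exact_mod_cast h1
    refine mul_le_mul ?_ ((ih _).2.trans (pow_le_pow_left₀ (harmonic_cast_nonneg _)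
      (harmonic_mono (by omega)) _)) (ih _).1 (by positivity)
    rw [one_div, Rat.cast_inv, Rat.cast_natCast]
    gcongr
    exact le_self_pow₀ hm1 (hk x (by simp)).ne'

theorem tTrunc_bounds {l : List ℕ} (hl : ∀ x ∈ l, 0 < x) (n : ℕ) :
    0 ≤ tTrunc l n ∧ tTrunc l n ≤ (harmonic n : ℝ) ^ l.length := by
  induction l generalizing n with
  | nil => simp [tTrunc]
  | cons x ls ih =>
    have ih := ih fun y hy => hl y (by simp [hy])
    have hpos : ∀ m ∈ Icc 1 n, (1 : ℝ) ≤ m := fun m hm => by exact_mod_cast (mem_Icc.1 hm).1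
    refine ⟨sum_nonneg fun m hm => mul_nonneg ?_ (ih _).1, ?_⟩
    · have : (0 : ℝ) ≤ 2 * m - 1 := by linarith [hpos m hm]
      positivity
    rw [tTrunc, List.length_cons, pow_succ']
    nth_rewrite 1 [harmonic_eq_sum_Icc]
    rw [Rat.cast_sum, sum_mul]
    refine sum_le_sum fun m hm => ?_
    have hm1 := hpos m hm
    refine mul_le_mul ?_ ((ih _).2.trans (pow_le_pow_left₀ (harmonic_cast_nonneg _)
      (harmonic_mono (by have := mem_Icc.1 hm; omega)) _)) (ih _).1 (by simp)
    rw [one_div, Rat.cast_inv, Rat.cast_natCast]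
    refine inv_anti₀ (by linarith) ?_
    calc (m : ℝ) ≤ 2 * m - 1 := by linarith
      _ ≤ (2 * m - 1) ^ x := le_self_pow₀ (by linarith) (hl x (by simp)).ne'

/-- The product `ζ_n(k) t_n(l)`. -/
noncomputable def zt (k l : List ℕ) (n : ℕ) : ℂ := ((zetaTrunc k n * tTrunc l n : ℝ) : ℂ)

/-- The product `ζ_{n-1}(k) t_n(l)`. -/
noncomputable def ztPred (k l : List ℕ) (n : ℕ) : ℂ :=
  ((zetaTrunc k (n - 1) * tTrunc l n : ℝ) : ℂ)

section truncated

variable {k l : List ℕ}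

theorem exists_zt_le (hk : ∀ x ∈ k, 0 < x) (hl : ∀ x ∈ l, 0 < x) :
    ∃ K : ℝ, 0 ≤ K ∧ ∀ n : ℕ, |zetaTrunc k n * tTrunc l n| ≤ K * ((n : ℝ) + 1) ^ (1 / 4 : ℝ) := by
  obtain ⟨K, hK, h⟩ := exists_harmonic_pow_le (k.length + l.length)
  refine ⟨K, hK, fun n => le_trans ?_ (h n)⟩
  have h1 := zetaTrunc_bounds hk n
  have h2 := tTrunc_bounds hl n
  rw [abs_of_nonneg (mul_nonneg h1.1 h2.1), pow_add]
  exact mul_le_mul h1.2 h2.2 h2.1 (pow_nonneg (harmonic_cast_nonneg _) _)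

theorem polyGrowth_ofReal_of_le_harmonic {f : ℕ → ℝ} {j : ℕ}
    (h : ∀ n, 0 ≤ f n ∧ f n ≤ (harmonic n : ℝ) ^ j) : PolyGrowth fun n => (f n : ℂ) := by
  obtain ⟨K, hK, hb⟩ := exists_harmonic_pow_le j
  refine ⟨K, 1, hK, fun n => ?_⟩
  rw [Complex.norm_real, Real.norm_of_nonneg (h n).1, pow_one]
  refine ((h n).2.trans (hb n)).trans ?_
  gcongr
  exact Real.rpow_le_self_of_one_le (by simp) (by norm_num)

theorem polyGrowth_zt (hk : ∀ x ∈ k, 0 < x) (hl : ∀ x ∈ l, 0 < x) : PolyGrowth (zt k l) := by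
  have := (polyGrowth_ofReal_of_le_harmonic (zetaTrunc_bounds hk)).mul
    (polyGrowth_ofReal_of_le_harmonic (tTrunc_bounds hl))
  exact this.of_le fun n => by simp [zt]

theorem polyGrowth_ztPred (hk : ∀ x ∈ k, 0 < x) (hl : ∀ x ∈ l, 0 < x) :
    PolyGrowth (ztPred k l) := by
  have := (polyGrowth_ofReal_of_le_harmonic (zetaTrunc_bounds hk)).pred.mul
    (polyGrowth_ofReal_of_le_harmonic (tTrunc_bounds hl))
  exact this.of_le fun n => by simp [ztPred]

theorem ztPred_nil_nil : ztPred [] [] = fun _ => 1 := by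
  ext n; simp [ztPred, zetaTrunc, tTrunc]

theorem ztPred_cons_nil (x : ℕ) (hx : 0 < x) (k : List ℕ) (n : ℕ) (hn : 1 ≤ n) :
    ztPred (x :: k) [] n
      = ((2 ^ x : ℚ) : ℂ) * ∑ m ∈ range n, ztPred k [] m / ((2 * m : ℕ) : ℂ) ^ x := by
  induction n, hn using Nat.le_induction with
  | base => simp [ztPred, zetaTrunc_cons_zero, hx.ne']
  | succ n hn ih =>
    obtain ⟨m, rfl⟩ : ∃ m, n = m + 1 := ⟨n - 1, by omega⟩
    rw [sum_range_succ, mul_add, ← ih]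
    simp only [ztPred, Nat.add_sub_cancel, zetaTrunc_cons_succ, tTrunc]
    push_cast
    have : (m : ℂ) + 1 ≠ 0 := by exact_mod_cast Nat.succ_ne_zero m
    rw [mul_pow]
    field_simp

theorem ztPred_nil_cons (y : ℕ) (l : List ℕ) (n : ℕ) :
    ztPred [] (y :: l) n = ∑ m ∈ range n, zt [] l m / ((2 * m + 1 : ℕ) : ℂ) ^ y := by
  induction n with
  | zero => simp [ztPred, tTrunc_cons_zero]
  | succ n ih =>
    rw [sum_range_succ, ← ih]
    simp only [ztPred, zt, tTrunc_cons_succ, zetaTrunc]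
    push_cast
    ring

/-- With indices read as `2m` and `2r - 1`, `ztPred` at `n` collects the indices below `2n` and `zt`
those below `2n + 1`. The largest index is either some `2m`, leaving `ztPred` at `m`, or some `2m +
1`, leaving `zt` at `m`. The power of 2 turns `(2m)^{-x}` into `m^{-x}`. -/
theorem ztPred_cons_cons (x : ℕ) (hx : 0 < x) (k : List ℕ) (y : ℕ) (l : List ℕ) (n : ℕ)
    (hn : 1 ≤ n) :
    ztPred (x :: k) (y :: l) n
      = ((2 ^ x : ℚ) : ℂ) * ∑ m ∈ range n, ztPred k (y :: l) m / ((2 * m : ℕ) : ℂ) ^ x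
        + ∑ m ∈ range n, zt (x :: k) l m / ((2 * m + 1 : ℕ) : ℂ) ^ y := by
  induction n, hn using Nat.le_induction with
  | base => simp [ztPred, zt, zetaTrunc_cons_zero, hx.ne']
  | succ n hn ih =>
    obtain ⟨m, rfl⟩ : ∃ m, n = m + 1 := ⟨n - 1, by omega⟩
    rw [sum_range_succ _ (m + 1), sum_range_succ _ (m + 1), mul_add, add_add_add_comm, ← ih]
    simp only [ztPred, zt, Nat.add_sub_cancel]
    rw [tTrunc_cons_succ y l (m + 1), zetaTrunc_cons_succ]
    push_cast
    have : (m : ℂ) + 1 ≠ 0 := by exact_mod_cast Nat.succ_ne_zero m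
    have := two_mul_add_one_ne (m + 1)
    push_cast at this
    rw [mul_pow]
    field_simp
    ring

theorem zt_nil_right (k : List ℕ) : zt k [] = fun n => ztPred k [] (n + 1) := by
  ext n; simp [zt, ztPred, tTrunc]

/-- Passing from indices below `2n + 2` to those below `2n + 1` removes the terms whose largest
index is `2n + 1`. -/
theorem zt_cons_right (k : List ℕ) (y : ℕ) (l : List ℕ) :
    zt k (y :: l) = fun n => ztPred k (y :: l) (n + 1)
      - zt k l n / ((2 * n + 1 : ℕ) : ℂ) ^ y := by
  ext n
  simp only [zt, ztPred, Nat.add_sub_cancel, tTrunc_cons_succ]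
  push_cast
  ring

theorem zt_cons_left (x : ℕ) (k l : List ℕ) (n : ℕ) (hn : 1 ≤ n) :
    zt (x :: k) l n = ztPred (x :: k) l n
      + ((2 ^ x : ℚ) : ℂ) * (ztPred k l n / ((2 * n : ℕ) : ℂ) ^ x) := by
  obtain ⟨m, rfl⟩ : ∃ m, n = m + 1 := ⟨n - 1, by omega⟩
  simp only [zt, ztPred, Nat.add_sub_cancel, zetaTrunc_cons_succ]
  push_cast
  have : (m : ℂ) + 1 ≠ 0 := by exact_mod_cast Nat.succ_ne_zero m
  rw [mul_pow]
  field_simp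

/-- `D` may be the inner part of a nested sum whose outer index is odd. -/
def OddGood (w : ℕ) (D : ℕ → ℂ) : Prop :=
  PolyGrowth D ∧
    (∀ s, 1 ≤ s → Good (w + s) fun n => ∑ m ∈ range n, D m / ((2 * m + 1 : ℕ) : ℂ) ^ s) ∧
    ∀ s, 2 ≤ s → IsConv (w + s) fun u => Complex.I * oddSeries s D u

theorem Good.oddGood {w : ℕ} {C : ℕ → ℂ} (h : Good w C) : OddGood w fun n => C (n + 1) :=
  ⟨h.1.shift, fun _ hs => h.odd_step hs, fun _ hs => h.oddSeries hs⟩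

theorem oddSeries_sub_div {A B : ℕ → ℂ} (hA : PolyGrowth A) (hB : PolyGrowth B) (s y : ℕ) {u : ℝ}
    (hu : u ∈ Set.Ico (0 : ℝ) 1) :
    oddSeries s (fun n => A n - B n / ((2 * n + 1 : ℕ) : ℂ) ^ y) u
      = oddSeries s A u + (-1) * oddSeries (y + s) B u := by
  simp only [oddSeries, psSin]
  rw [mul_left_comm, ← mul_add, ← ps_const_mul _ (-1),
    ← ps_add (polyGrowth_odd hA s) ((polyGrowth_odd hB (y + s)).const_mul _)
    (norm_sinU_sq_lt_one hu)]
  congr 2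
  ext n
  have := two_mul_add_one_ne n
  push_cast
  rw [pow_add]
  field_simp
  ring

/-- The correction merges with the outer denominator into exponent `y + s`, so the total weight is
unchanged. -/
theorem OddGood.sub_div {w w' y : ℕ} {A B : ℕ → ℂ} (hA : OddGood w A) (hB : OddGood w' B)
    (hw : w' + y = w) : OddGood w fun n => A n - B n / ((2 * n + 1 : ℕ) : ℂ) ^ y := by
  refine ⟨hA.1.sub (hB.1.div_pow y), fun s hs => ?_, fun s hs => ?_⟩
  · have h1 := hA.2.1 s hs
    have h2 := (hB.2.1 (y + s) (by omega)).const_mul (-1)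
    rw [← add_assoc, hw] at h2
    convert h1.add h2 using 2 with n
    rw [mul_sum, ← sum_add_distrib]
    refine sum_congr rfl fun m _ => ?_
    have := two_mul_add_one_ne m
    push_cast
    rw [pow_add]
    field_simp
    ring
  · have h1 := hA.2.2 s hs
    have h2 := (hB.2.2 (y + s) (by omega)).const_mul (-1)
    rw [← add_assoc, hw] at h2
    refine (h1.add h2).congr fun u hu => ?_
    rw [oddSeries_sub_div hA.1 hB.1 s y hu]
    push_cast
    ring

/-- Removing an odd largest index shortens `l` and leaves `k` whole, so the outer induction is on
`l` with all `k` at once; removing an even one is the inner induction on `k`. -/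
theorem good_ztPred_and_oddGood_zt (hl : ∀ x ∈ l, 0 < x) : ∀ k : List ℕ, (∀ x ∈ k, 0 < x) →
    Good (k.sum + l.sum) (ztPred k l) ∧ OddGood (k.sum + l.sum) (zt k l) := by
  induction l with
  | nil =>
    have hgood : ∀ k : List ℕ, (∀ x ∈ k, 0 < x) →
        Good (k.sum + ([] : List ℕ).sum) (ztPred k []) := by
      intro k hk
      induction k with
      | nil => rw [ztPred_nil_nil]; exact good_one
      | cons x k ih =>
        have hx := hk x (by simp)
        have h := ((ih fun z hz => hk z (by simp [hz])).even_step (s := x) hx).const_mul (2 ^ x)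
        have hw : (x :: k).sum + ([] : List ℕ).sum = k.sum + ([] : List ℕ).sum + x := by
          simp [add_comm]
        rw [hw]
        exact h.congr (ztPred_cons_nil x hx k) (polyGrowth_ztPred hk hl)
    refine fun k hk => ⟨hgood k hk, ?_⟩
    rw [zt_nil_right]
    exact (hgood k hk).oddGood
  | cons y l ihl =>
    have hodd := fun k hk => (ihl (fun z hz => hl z (by simp [hz])) k hk).2
    have hy := hl y (by simp)
    have hgood : ∀ k : List ℕ, (∀ x ∈ k, 0 < x) →
        Good (k.sum + (y :: l).sum) (ztPred k (y :: l)) := by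
      intro k hk
      induction k with
      | nil =>
        have h := (hodd [] (by simp)).2.1 y hy
        have hw : ([] : List ℕ).sum + (y :: l).sum = ([] : List ℕ).sum + l.sum + y := by
          simp [add_comm]
        rw [hw]
        exact h.congr (fun n _ => ztPred_nil_cons y l n) (polyGrowth_ztPred hk hl)
      | cons x k ih =>
        have hx := hk x (by simp)
        have h := ((ih fun z hz => hk z (by simp [hz])).even_step (s := x) hx).const_mul (2 ^ x)
        have h2 := (hodd (x :: k) hk).2.1 y hy
        have hw : (x :: k).sum + (y :: l).sum = k.sum + (y :: l).sum + x := by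
          simp only [List.sum_cons]; omega
        have hw2 : (x :: k).sum + l.sum + y = k.sum + (y :: l).sum + x := by
          simp only [List.sum_cons]; omega
        rw [hw2] at h2
        rw [hw]
        exact (h.add h2).congr (ztPred_cons_cons x hx k y l) (polyGrowth_ztPred hk hl)
    refine fun k hk => ⟨hgood k hk, ?_⟩
    rw [zt_cons_right]
    exact (hgood k hk).oddGood.sub_div (hodd k hk) (by simp only [List.sum_cons]; omega)

theorem good_ztPred (hk : ∀ x ∈ k, 0 < x) (hl : ∀ x ∈ l, 0 < x) :
    Good (k.sum + l.sum) (ztPred k l) := (good_ztPred_and_oddGood_zt hl k hk).1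

theorem isConv_oddSeries_zt (hk : ∀ x ∈ k, 0 < x) (hl : ∀ x ∈ l, 0 < x) {s : ℕ} (hs : 2 ≤ s) :
    IsConv (k.sum + l.sum + s) fun u => Complex.I * oddSeries s (zt k l) u :=
  (good_ztPred_and_oddGood_zt hl k hk).2.2.2 s hs

theorem evenSeries_add_div {A B : ℕ → ℂ} (hA : PolyGrowth A) (hB : PolyGrowth B) (q : ℚ) {s : ℕ}
    (x : ℕ) {u : ℝ} (hu : u ∈ Set.Ico (0 : ℝ) 1) :
    evenSeries s (fun n => A n + (q : ℂ) * (B n / ((2 * n : ℕ) : ℂ) ^ x)) u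
      = evenSeries s A u + (q : ℂ) * evenSeries (x + s) B u := by
  simp only [evenSeries, psSin]
  rw [← ps_const_mul, ← ps_add (polyGrowth_even hA s) ((polyGrowth_even hB (x + s)).const_mul _)
    (norm_sinU_sq_lt_one hu)]
  congr 1
  ext n
  rw [pow_add]
  ring

theorem evenSeries_congr {C D : ℕ → ℂ} {s : ℕ} (hs : s ≠ 0) (h : ∀ n, 1 ≤ n → D n = C n) :
    evenSeries s D = evenSeries s C := by
  have : (fun n : ℕ => (aperyB n : ℂ) * D n / ((2 * n : ℕ) : ℂ) ^ s)
      = fun n : ℕ => (aperyB n : ℂ) * C n / ((2 * n : ℕ) : ℂ) ^ s := by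
    ext n
    rcases Nat.eq_zero_or_pos n with rfl | hn
    · simp [hs]
    · rw [h n hn]
  rw [evenSeries, evenSeries, this]

theorem isConv_evenSeries_zt (hk : ∀ x ∈ k, 0 < x) (hl : ∀ x ∈ l, 0 < x) {s : ℕ} (hs : 2 ≤ s) :
    IsConv (k.sum + l.sum + s) (evenSeries s (zt k l)) := by
  cases k with
  | nil =>
    have : zt [] l = ztPred [] l := by ext n; simp [zt, ztPred, zetaTrunc]
    rw [this]
    exact (good_ztPred hk hl).evenSeries hs
  | cons x k =>
    have hk' : ∀ z ∈ k, 0 < z := fun z hz => hk z (by simp [hz])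
    rw [evenSeries_congr (by omega) (zt_cons_left x k l)]
    have h1 := (good_ztPred hk hl).evenSeries hs
    have h2 := ((good_ztPred hk' hl).evenSeries (s := x + s) (by omega)).const_mul (2 ^ x)
    have hw : k.sum + l.sum + (x + s) = (x :: k).sum + l.sum + s := by
      simp only [List.sum_cons]; omega
    rw [hw] at h2
    exact (h1.add h2).congr fun u hu =>
      evenSeries_add_div (polyGrowth_ztPred hk hl) (polyGrowth_ztPred hk' hl) _ x hu

end truncated

/-! ### Wallis integrals and termwise integration. -/

/-- The integral of `sin ^ (2n+1)` from `0` to `t`, as a function of `u`. -/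
noncomputable def sinInt : ℕ → ℝ → ℝ
  | 0, u => 1 - cosU u
  | n + 1, u => ((2 * n + 2) * sinInt n u - sinU u ^ (2 * n + 2) * cosU u) / (2 * n + 3)

theorem sinInt_hasDerivAt (n : ℕ) (u : ℝ) :
    HasDerivAt (sinInt n) (sinU u ^ (2 * n + 1) * dthetaU u) u := by
  induction n with
  | zero => exact ((hasDerivAt_cosU u).const_sub 1).congr_deriv (by ring)
  | succ n ih =>
    have h := (((ih.const_mul (2 * (n : ℝ) + 2)).sub
      (((hasDerivAt_sinU u).pow (2 * n + 2)).mul (hasDerivAt_cosU u))).div_const (2 * (n : ℝ) + 3))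
    refine h.congr_deriv ?_
    have h3 : 2 * (n : ℝ) + 3 ≠ 0 := by positivity
    rw [div_eq_iff h3]
    have e : 2 * n + 2 - 1 = 2 * n + 1 := by omega
    have hsc := sinU_sq_add_cosU_sq u
    simp only [Pi.pow_apply, e]
    push_cast
    linear_combination (-(2 * (n : ℝ) + 2) * sinU u ^ (2 * n + 1) * dthetaU u) * hsc

theorem sinInt_zero_right (n : ℕ) : sinInt n 0 = 0 := by
  induction n with
  | zero => simp [sinInt, cosU]
  | succ n ih => simp [sinInt, ih, sinU_zero]

/-- Wallis: at `t = π / 2` the boundary term of the reduction formula vanishes, and the ratio left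
is that of `b_n / (2n+1)`. -/
theorem sinInt_one_right (n : ℕ) : sinInt n 1 = aperyB n / (2 * n + 1) := by
  induction n with
  | zero => simp [sinInt, cosU, aperyB_zero]
  | succ n ih =>
    have h := aperyB_succ n
    have h1 : 2 * (n : ℝ) + 1 ≠ 0 := by positivity
    have hc : cosU 1 = 0 := by simp [cosU]
    rw [sinInt, ih, hc]
    push_cast
    rw [show 2 * ((n : ℝ) + 1) + 1 = 2 * n + 3 by ring, mul_zero, sub_zero]
    congr 1
    field_simp
    linarith

theorem sinInt_monotoneOn (n : ℕ) : MonotoneOn (sinInt n) (Set.Icc 0 1) := by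
  refine monotoneOn_of_hasDerivWithinAt_nonneg (convex_Icc 0 1)
    (fun u _ => (sinInt_hasDerivAt n u).continuousAt.continuousWithinAt)
    (fun u _ => (sinInt_hasDerivAt n u).hasDerivWithinAt) fun u hu => ?_
  rw [interior_Icc] at hu
  have := sinU_nonneg hu.1.le
  unfold dthetaU
  positivity

theorem abs_sinInt_le {u : ℝ} (hu : u ∈ Set.Icc (0 : ℝ) 1) (n : ℕ) : |sinInt n u| ≤ sinInt n 1 := by
  have h0 := sinInt_monotoneOn n (by simp) hu hu.1
  rw [sinInt_zero_right] at h0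
  rw [abs_of_nonneg h0]
  exact sinInt_monotoneOn n hu (by simp) hu.2

theorem sinU_le_sinU {u r : ℝ} (hu : 0 ≤ u) (hur : u ≤ r) (hr : r ≤ 1) : sinU u ≤ sinU r := by
  unfold sinU
  rw [div_le_div_iff₀ (by positivity) (by positivity)]
  have : 0 ≤ (r - u) * (1 - u * r) :=
    mul_nonneg (sub_nonneg.2 hur) (by nlinarith)
  linarith

/-- Termwise integration of `d_n sin^{2n+1} t` over `[0, π/2]`. -/
theorem hasSum_mul_sinInt {d : ℕ → ℂ} (hd : PolyGrowth d)
    (hs : Summable fun n => ‖d n‖ * sinInt n 1) {H : ℝ → ℂ} {v : ℂ}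
    (hH : ContinuousOn H (Set.Ico 0 1)) (h0 : H 0 = 0)
    (hH' : ∀ u ∈ Set.Ioo (0 : ℝ) 1, HasDerivAt H (dthetaU u * (sinU u * psSin d u)) u)
    (hv : Tendsto H (𝓝[<] 1) (𝓝 v)) : HasSum (fun n => d n * (sinInt n 1 : ℂ)) v := by
  -- The termwise integral converges uniformly up to `u = 1`, since each `sinInt n` is largest
  -- there. It has the derivative of `H`, hence equals `H` on `[0, 1)`, and its value at 1 is the
  -- limit of `H`.
  set G : ℝ → ℂ := fun u => ∑' n, d n * (sinInt n u : ℂ) with hG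
  have hb : ∀ n, ∀ u ∈ Set.Icc (0 : ℝ) 1, ‖d n * (sinInt n u : ℂ)‖ ≤ ‖d n‖ * sinInt n 1 :=
    fun n u hu => by
      rw [norm_mul, Complex.norm_real, Real.norm_eq_abs]
      exact mul_le_mul_of_nonneg_left (abs_sinInt_le hu n) (norm_nonneg _)
  have hcont : ContinuousOn G (Set.Icc 0 1) :=
    continuousOn_tsum (fun n => continuousOn_const.mul (Complex.continuous_ofReal.comp_continuousOn
      fun u _ => (sinInt_hasDerivAt n u).continuousAt.continuousWithinAt)) hs hb
  have hG0 : G 0 = 0 := by simp [hG, sinInt_zero_right]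
  have hG' : ∀ u ∈ Set.Ioo (0 : ℝ) 1,
      HasDerivAt G (dthetaU u * (sinU u * psSin d u)) u := by
    intro u hu
    obtain ⟨r, hur, hr1⟩ := exists_between hu.2
    have hr : r ∈ Set.Ico (0 : ℝ) 1 := ⟨(hu.1.trans hur).le, hr1⟩
    have hsum : Summable fun n => ‖d n * ((sinU r : ℂ) ^ 2) ^ n‖ * 2 :=
      (hd.summable_norm (norm_sinU_sq_lt_one hr)).mul_right 2
    refine (hasDerivAt_tsum_of_isPreconnected hsum isOpen_Ioo isPreconnected_Ioo
      (g := fun n u => d n * (sinInt n u : ℂ))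
      (g' := fun n u => d n * ((sinU u ^ (2 * n + 1) * dthetaU u : ℝ) : ℂ)) (t := Set.Ioo 0 r)
      (fun n y _ => (sinInt_hasDerivAt n y).ofReal_comp.const_mul (d n)) (fun n y hy => ?_)
      (y₀ := u) ⟨hu.1, hur⟩ (Summable.of_norm_bounded hs fun n => hb n u ⟨hu.1.le, hu.2.le⟩)
      ⟨hu.1, hur⟩).congr_deriv ?_
    · have hy1 : y ∈ Set.Ico (0 : ℝ) 1 := ⟨hy.1.le, hy.2.trans hr1⟩
      have hsy := sinU_nonneg hy1.1
      have hth : 0 ≤ dthetaU y ∧ dthetaU y ≤ 2 := by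
        unfold dthetaU
        exact ⟨by positivity, div_le_self (by norm_num) (by nlinarith [sq_nonneg y])⟩
      rw [norm_mul, norm_mul, mul_assoc, Complex.norm_real, Real.norm_of_nonneg
        (mul_nonneg (pow_nonneg hsy _) hth.1), ← pow_mul, norm_pow, Complex.norm_real,
        Real.norm_of_nonneg (sinU_nonneg hr.1)]
      refine mul_le_mul_of_nonneg_left (mul_le_mul ?_ hth.2 hth.1 (pow_nonneg (sinU_nonneg hr.1) _))
        (norm_nonneg _)
      rw [pow_succ]
      exact (mul_le_of_le_one_right (pow_nonneg hsy _) (sinU_lt_one hy1).le).trans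
        (pow_le_pow_left₀ hsy (sinU_le_sinU hy1.1 hy.2.le hr1.le) _)
    · rw [psSin, ps, ← tsum_mul_left, ← tsum_mul_left]
      congr 1
      ext n
      push_cast
      rw [← pow_mul]
      ring
  have heq := eqOn_of_hasDerivAt_eq hH (hcont.mono Set.Ico_subset_Icc_self) (h0.trans hG0.symm)
    hH' hG'
  have hlim : Tendsto G (𝓝[<] 1) (𝓝 (G 1)) := by
    refine (hcont 1 (by simp)).mono_left ?_
    rw [← nhdsWithin_Ioo_eq_nhdsLT (zero_lt_one (α := ℝ))]
    exact nhdsWithin_mono _ Set.Ioo_subset_Icc_self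
  have hv' : Tendsto G (𝓝[<] 1) (𝓝 v) := hv.congr' (by
    filter_upwards [Ioo_mem_nhdsLT (zero_lt_one (α := ℝ))] with u hu
    exact heq u (Set.Ioo_subset_Ico_self hu))
  rw [tendsto_nhds_unique hv' hlim]
  exact (Summable.of_norm_bounded hs fun n => hb n 1 (by simp)).hasSum

/-! ### Passage to t = π / 2 and absolute convergence. -/

theorem tendsto_sinU : Tendsto sinU (𝓝[<] 1) (𝓝 1) := by
  have h : Tendsto sinU (𝓝 1) (𝓝 (sinU 1)) := (hasDerivAt_sinU 1).continuousAt
  have h1 : sinU 1 = 1 := by norm_num [sinU]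
  rw [h1] at h
  exact h.mono_left nhdsWithin_le_nhds

/-- A convergent power series in `sin² t` is continuous up to `t = π / 2`. -/
theorem psSin_tendsto {a : ℕ → ℂ} {l : ℂ} (h : HasSum a l) :
    Tendsto (psSin a) (𝓝[<] 1) (𝓝 l) := by
  have h1 : Tendsto (fun u => sinU u ^ 2) (𝓝[<] 1) (𝓝[<] 1) := by
    refine tendsto_nhdsWithin_of_tendsto_nhds_of_eventually_within _
      (by simpa using tendsto_sinU.pow 2) ?_
    filter_upwards [Ioo_mem_nhdsLT (zero_lt_one (α := ℝ))] with u hu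
    exact (sinU_sq_mem (Set.Ioo_subset_Ico_self hu)).2
  refine ((ps_tendsto_one h.tendsto_sum_nat).comp h1).congr fun u => ?_
  simp [psSin]

theorem hasSum_congr {f g : ℕ → ℂ} {a : ℂ} (h : ∀ n, f n = g n) : HasSum f a ↔ HasSum g a := by
  rw [funext h]

section summability

variable {f : ℕ → ℝ} {K : ℝ} {d : ℕ → ℕ}

/-- The case `e = 0` serves the denominator `2n` at `n = 0`, where the quotient is zero. -/
theorem rpow_bound_div (n : ℕ) {x : ℝ} (hx : 0 ≤ x) {e : ℕ} (he : e = 0 ∨ n + 1 ≤ e) {p q : ℕ}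
    (hp : p ≠ 0) (hpq : p ≤ q) : x / (e : ℝ) ^ q ≤ x / ((n : ℝ) + 1) ^ p := by
  rcases he with rfl | he
  · rw [Nat.cast_zero, zero_pow (by omega), div_zero]
    positivity
  · have h1 : (n : ℝ) + 1 ≤ e := by exact_mod_cast he
    have h2 : (1 : ℝ) ≤ (n : ℝ) + 1 := by simp
    gcongr
    calc ((n : ℝ) + 1) ^ p ≤ ((n : ℝ) + 1) ^ q := pow_le_pow_right₀ h2 hpq
      _ ≤ (e : ℝ) ^ q := by gcongr

theorem summable_aperyB_mul (hf : ∀ n : ℕ, |f n| ≤ K * ((n : ℝ) + 1) ^ (1 / 4 : ℝ))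
    (hd : ∀ n, d n = 0 ∨ n + 1 ≤ d n) {p : ℕ} (hp : 2 ≤ p) :
    Summable fun n => aperyB n * f n / (d n : ℝ) ^ p := by
  -- The exponent is `1/2 + 1/4 - 2`: from `b_n`, from the truncated sums, and from the denominator.
  have hs : Summable fun n : ℕ => 2 * K * ((n : ℝ) + 1) ^ (-(5 / 4) : ℝ) := by
    have h := (Real.summable_nat_rpow (p := -(5 / 4))).2 (by norm_num)
    simpa using ((summable_nat_add_iff 1).2 h).mul_left (2 * K)
  refine Summable.of_norm_bounded hs fun n => ?_
  have hn : (0 : ℝ) < (n : ℝ) + 1 := by positivity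
  have hb : aperyB n ≤ 2 * ((n : ℝ) + 1) ^ (1 / 2 : ℝ) := by
    rw [← Real.sqrt_eq_rpow]
    refine (pow_le_pow_iff_left₀ (aperyB_pos n).le (by positivity) two_ne_zero).1 ?_
    rw [mul_pow, Real.sq_sqrt hn.le]
    linarith [aperyB_sq_le n]
  rw [norm_div, norm_mul, norm_pow, Real.norm_natCast, Real.norm_of_nonneg (aperyB_pos n).le,
    Real.norm_eq_abs]
  refine (rpow_bound_div n (mul_nonneg (aperyB_pos n).le (abs_nonneg _)) (hd n) two_ne_zero
    hp).trans ?_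
  rw [div_le_iff₀ (by positivity)]
  calc aperyB n * |f n|
      ≤ (2 * ((n : ℝ) + 1) ^ (1 / 2 : ℝ)) * (K * ((n : ℝ) + 1) ^ (1 / 4 : ℝ)) :=
        mul_le_mul hb (hf n) (abs_nonneg _) (by positivity)
    _ = 2 * K * (((n : ℝ) + 1) ^ (1 / 2 : ℝ) * ((n : ℝ) + 1) ^ (1 / 4 : ℝ)) := by ring
    _ = 2 * K * (((n : ℝ) + 1) ^ (-(5 / 4) : ℝ) * ((n : ℝ) + 1) ^ (2 : ℕ)) := by
        rw [← Real.rpow_add hn, ← Real.rpow_natCast, ← Real.rpow_add hn]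
        norm_num
    _ = _ := by ring

theorem summable_aperyB_sq_mul (hf : ∀ n : ℕ, |f n| ≤ K * ((n : ℝ) + 1) ^ (1 / 4 : ℝ))
    (hd : ∀ n, d n = 0 ∨ n + 1 ≤ d n) {q : ℕ} (hq : 3 ≤ q) :
    Summable fun n => aperyB n ^ 2 * f n / (d n : ℝ) ^ q := by
  refine Summable.of_norm_bounded (summable_rpow_bound (4 * K)) fun n => ?_
  have hn : (0 : ℝ) < (n : ℝ) + 1 := by positivity
  rw [norm_div, norm_mul, norm_pow, norm_pow, Real.norm_natCast,
    Real.norm_of_nonneg (aperyB_pos n).le, Real.norm_eq_abs]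
  refine (rpow_bound_div n (mul_nonneg (sq_nonneg _) (abs_nonneg _)) (hd n) three_ne_zero
    hq).trans ?_
  rw [div_le_iff₀ (by positivity)]
  calc aperyB n ^ 2 * |f n|
      ≤ (4 * ((n : ℝ) + 1)) * (K * ((n : ℝ) + 1) ^ (1 / 4 : ℝ)) :=
        mul_le_mul (by linarith [aperyB_sq_le n]) (hf n) (abs_nonneg _) (by positivity)
    _ = 4 * K * (((n : ℝ) + 1) ^ (1 : ℝ) * ((n : ℝ) + 1) ^ (1 / 4 : ℝ)) := by
        rw [Real.rpow_one]; ring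
    _ = 4 * K * (((n : ℝ) + 1) ^ (-(7 / 4) : ℝ) * ((n : ℝ) + 1) ^ (3 : ℕ)) := by
        rw [← Real.rpow_add hn, ← Real.rpow_natCast, ← Real.rpow_add hn]
        norm_num
    _ = _ := by ring

end summability

/-! ### The four families of values. -/

variable {k l : List ℕ} {p q : ℕ}

theorem hasSum_even (hk : ∀ x ∈ k, 0 < x) (hl : ∀ x ∈ l, 0 < x) (hp : 2 ≤ p) :
    ∃ v ∈ CMZV 4 (k.sum + l.sum + p),
      HasSum (fun n => aperyB n * zt k l n / ((2 * n : ℕ) : ℂ) ^ p) v := by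
  obtain ⟨K, -, hf⟩ := exists_zt_le hk hl
  have hs := summable_aperyB_mul hf (d := fun n => 2 * n) (fun n => by omega) hp
  obtain ⟨v, hv, hlim⟩ := (isConv_evenSeries_zt hk hl hp).exists_tendsto
  have h2 := Complex.hasSum_ofReal.2 hs.hasSum
  have h3 := (hasSum_congr (g := fun n : ℕ => aperyB n * zt k l n / ((2 * n : ℕ) : ℂ) ^ p)
    fun n => by simp [zt]).1 h2
  refine ⟨v, hv, ?_⟩
  rw [tendsto_nhds_unique hlim (psSin_tendsto h3)]
  exact h3

theorem hasSum_odd (hk : ∀ x ∈ k, 0 < x) (hl : ∀ x ∈ l, 0 < x) (hp : 2 ≤ p) :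
    ∃ v ∈ CMZV 4 (k.sum + l.sum + p),
      HasSum (fun n => aperyB n * zt k l n / ((2 * n + 1 : ℕ) : ℂ) ^ p) (Complex.I * v) := by
  obtain ⟨K, -, hf⟩ := exists_zt_le hk hl
  have hs := summable_aperyB_mul hf (d := fun n => 2 * n + 1) (fun n => by omega) hp
  obtain ⟨v, hv, hlim⟩ := (isConv_oddSeries_zt hk hl hp).exists_tendsto
  have h2 := Complex.hasSum_ofReal.2 hs.hasSum
  have h3 := (hasSum_congr (g := fun n : ℕ => aperyB n * zt k l n / ((2 * n + 1 : ℕ) : ℂ) ^ p)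
    fun n => by simp [zt]).1 h2
  have h4 := ((Complex.continuous_ofReal.tendsto 1).comp tendsto_sinU).mul (psSin_tendsto h3)
  have h5 := tendsto_nhds_unique hlim (h4.const_mul Complex.I)
  -- Here `v` is the limit of `i` times the odd series, so the sum is `-i v = i (-v)`.
  refine ⟨-v, neg_mem hv, ?_⟩
  convert h3 using 1
  rw [h5, Complex.ofReal_one, one_mul, ← neg_mul_eq_mul_neg, ← mul_assoc]
  simp

/-- Dividing the even series by `sin t` leaves the odd powers `sin^{2n+1} t` with coefficient of
index `n + 1`. Their integrals `b_n / (2n+1) = b_{n+1} / (2n+2)` supply the second weight and one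
more power of the denominator. -/
theorem hasSum_even_sq (hk : ∀ x ∈ k, 0 < x) (hl : ∀ x ∈ l, 0 < x) (hq : 3 ≤ q) :
    ∃ v ∈ CMZV 4 (k.sum + l.sum + q),
      HasSum (fun n => aperyB (n + 1) ^ 2 * zt k l (n + 1) / ((2 * (n + 1) : ℕ) : ℂ) ^ q) v := by
  obtain ⟨s, rfl⟩ : ∃ s, q = s + 1 := ⟨q - 1, by omega⟩
  obtain ⟨K, -, hf⟩ := exists_zt_le hk hl
  have hs := summable_aperyB_sq_mul hf (d := fun n => 2 * n) (fun n => by omega) hq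
  set e : ℕ → ℂ := fun n => aperyB n * zt k l n / ((2 * n : ℕ) : ℂ) ^ s with he
  have hpe : PolyGrowth e := polyGrowth_even (polyGrowth_zt hk hl) s
  have hterm : ∀ n, e (n + 1) * (sinInt n 1 : ℂ)
      = aperyB (n + 1) ^ 2 * zt k l (n + 1) / ((2 * (n + 1) : ℕ) : ℂ) ^ (s + 1) := by
    intro n
    have h := aperyB_succ_complex n
    have h1 := two_mul_add_one_ne n
    have h2 := two_mul_add_two_ne n
    have h3 : (aperyB n : ℂ) / (2 * n + 1) = aperyB (n + 1) / (2 * n + 2) := by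
      rw [div_eq_div_iff h1 h2]; linear_combination -h
    simp only [he, sinInt_one_right]
    push_cast
    rw [h3, mul_add, mul_one, div_mul_div_comm, ← pow_succ]
    ring
  obtain ⟨H, hconv, hcont, h0, hH'⟩ := (isConv_evenSeries_zt hk hl (s := s)
    (by omega)).isPoly.exists_primitive (q₀ := 1) (q₂ := 0) (q₃ := 0) (q₄ := 0)
    (Or.inl (by omega : 1 ≤ k.sum + l.sum + s))
  obtain ⟨v, hv, hlim⟩ := hconv.exists_tendsto
  refine ⟨v, hv, ?_⟩
  simp only [← hterm]
  refine hasSum_mul_sinInt hpe.shift ?_ hcont h0 (fun u hu => (hH' u hu).congr_deriv ?_) hlim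
  · refine ((summable_nat_add_iff 1).2 hs.abs).congr fun n => ?_
    have hpos : 0 ≤ sinInt n 1 := (abs_nonneg _).trans (abs_sinInt_le (u := 1) (by simp) n)
    have := congrArg norm (hterm n)
    rw [norm_mul, Complex.norm_real, Real.norm_of_nonneg hpos] at this
    rw [this, ← Real.norm_eq_abs, ← Complex.norm_real]
    simp [zt]
  · have hu' := Set.Ioo_subset_Ico_self hu
    have hsin : (sinU u : ℂ) ≠ 0 := by exact_mod_cast (sinU_pos hu.1).ne'
    have hs0 : s ≠ 0 := by omega
    have he0 : e 0 = 0 := by simp [he, hs0]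
    rw [form_csc hu, evenSeries, psSin, ps_eq_head_add hpe (norm_sinU_sq_lt_one hu'), he0, psSin]
    field_simp
    ring

/-- The function `i` times the odd series is integrated against `-i dt`, so the factors `i` cancel
and none is left in the value. -/
theorem hasSum_odd_sq (hk : ∀ x ∈ k, 0 < x) (hl : ∀ x ∈ l, 0 < x) (hq : 3 ≤ q) :
    ∃ v ∈ CMZV 4 (k.sum + l.sum + q),
      HasSum (fun n => aperyB n ^ 2 * zt k l n / ((2 * n + 1 : ℕ) : ℂ) ^ q) v := by
  obtain ⟨s, rfl⟩ : ∃ s, q = s + 1 := ⟨q - 1, by omega⟩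
  obtain ⟨K, -, hf⟩ := exists_zt_le hk hl
  have hs := summable_aperyB_sq_mul hf (d := fun n => 2 * n + 1) (fun n => by omega) hq
  set e : ℕ → ℂ := fun n => aperyB n * zt k l n / ((2 * n + 1 : ℕ) : ℂ) ^ s with he
  have hpe : PolyGrowth e := polyGrowth_odd (polyGrowth_zt hk hl) s
  have hterm : ∀ n, e n * (sinInt n 1 : ℂ)
      = aperyB n ^ 2 * zt k l n / ((2 * n + 1 : ℕ) : ℂ) ^ (s + 1) := by
    intro n
    simp only [he, sinInt_one_right]
    push_cast
    rw [div_mul_div_comm, ← pow_succ]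
    ring
  obtain ⟨H, hconv, hcont, h0, hH'⟩ := (isConv_oddSeries_zt hk hl (s := s)
    (by omega)).isPoly.exists_primitive (q₀ := 0) (q₂ := 0) (q₃ := -1) (q₄ := 1) (Or.inr rfl)
  obtain ⟨v, hv, hlim⟩ := hconv.exists_tendsto
  refine ⟨v, hv, ?_⟩
  simp only [← hterm]
  refine hasSum_mul_sinInt hpe ?_ hcont h0 (fun u hu => (hH' u hu).congr_deriv ?_) hlim
  · refine hs.abs.congr fun n => ?_
    have hpos : 0 ≤ sinInt n 1 := (abs_nonneg _).trans (abs_sinInt_le (u := 1) (by simp) n)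
    have := congrArg norm (hterm n)
    rw [norm_mul, Complex.norm_real, Real.norm_of_nonneg hpos] at this
    rw [this, ← Real.norm_eq_abs, ← Complex.norm_real]
    simp [zt]
  · rw [form_neg_dtheta, oddSeries]
    linear_combination (-(dthetaU u : ℂ) * (sinU u * psSin e u)) * Complex.I_sq

/-- A complex value of a real series is the value of the real series. -/
theorem exists_real_hasSum {f : ℕ → ℝ} {v : ℂ} (h : HasSum (fun n => (f n : ℂ)) v) :
    ∃ S : ℝ, HasSum f S ∧ (S : ℂ) = v := by
  have hs : Summable f := Complex.summable_ofReal.1 h.summable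
  exact ⟨_, hs.hasSum, (Complex.hasSum_ofReal.2 hs.hasSum).unique h⟩

end AperySeries

open AperySeries in
theorem mainTheorem6 (p q : ℕ) (hp : 2 ≤ p) (hq : 3 ≤ q) (k l : List ℕ)
    (hk : ∀ x ∈ k, 0 < x) (hl : ∀ x ∈ l, 0 < x) :
    -- (a), with the summation index `n ≥ 1` written as `n + 1`
    (∃ S : ℝ,
      HasSum (fun n : ℕ => aperyB (n + 1) *
        (zetaTrunc k (n + 1) * tTrunc l (n + 1) / ((n + 1 : ℕ) : ℝ) ^ p)) S ∧
      (S : ℂ) ∈ CMZV 4 (k.sum + l.sum + p)) ∧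
    -- (b), with the summation index `n ≥ 1` written as `n + 1`
    (∃ S : ℝ,
      HasSum (fun n : ℕ => aperyB (n + 1) ^ 2 *
        (zetaTrunc k (n + 1) * tTrunc l (n + 1) / ((n + 1 : ℕ) : ℝ) ^ q)) S ∧
      (S : ℂ) ∈ CMZV 4 (k.sum + l.sum + q)) ∧
    -- (c)
    (∃ S : ℝ,
      HasSum (fun n : ℕ => aperyB n *
        (zetaTrunc k n * tTrunc l n / (2 * (n : ℝ) + 1) ^ p)) S ∧
      ∃ v ∈ CMZV 4 (k.sum + l.sum + p), (S : ℂ) = Complex.I * v) ∧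
    -- (d)
    (∃ S : ℝ,
      HasSum (fun n : ℕ => aperyB n ^ 2 *
        (zetaTrunc k n * tTrunc l n / (2 * (n : ℝ) + 1) ^ q)) S ∧
      (S : ℂ) ∈ CMZV 4 (k.sum + l.sum + q)) := by
  refine ⟨?_, ?_, ?_, ?_⟩
  · obtain ⟨v, hv, h⟩ := hasSum_even hk hl hp
    have h1 := (hasSum_nat_add_iff' 1).2 h
    rw [Finset.sum_range_one, Nat.mul_zero, Nat.cast_zero, zero_pow (by omega), div_zero,
      sub_zero] at h1
    -- The rational factor `2 ^ p` passes from the denominators `(2n) ^ p` to `n ^ p`.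
    obtain ⟨S, hS, hSv⟩ := exists_real_hasSum (f := fun n : ℕ => aperyB (n + 1) *
        (zetaTrunc k (n + 1) * tTrunc l (n + 1) / ((n + 1 : ℕ) : ℝ) ^ p)) (v := ((2 ^ p : ℚ) : ℂ) * v)
      (by
        refine (hasSum_congr fun n => ?_).2 (h1.mul_left ((2 ^ p : ℚ) : ℂ))
        have : (n : ℂ) + 1 ≠ 0 := by exact_mod_cast Nat.succ_ne_zero n
        simp only [zt]
        push_cast
        rw [mul_pow]
        field_simp)
    refine ⟨S, hS, ?_⟩
    rw [hSv, ← Rat.smul_def]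
    exact Submodule.smul_mem _ _ hv
  · obtain ⟨v, hv, h⟩ := hasSum_even_sq hk hl hq
    obtain ⟨S, hS, hSv⟩ := exists_real_hasSum (f := fun n : ℕ => aperyB (n + 1) ^ 2 *
        (zetaTrunc k (n + 1) * tTrunc l (n + 1) / ((n + 1 : ℕ) : ℝ) ^ q)) (v := ((2 ^ q : ℚ) : ℂ) * v)
      (by
        refine (hasSum_congr fun n => ?_).2 (h.mul_left ((2 ^ q : ℚ) : ℂ))
        have : (n : ℂ) + 1 ≠ 0 := by exact_mod_cast Nat.succ_ne_zero n
        simp only [zt]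
        push_cast
        rw [mul_pow]
        field_simp)
    refine ⟨S, hS, ?_⟩
    rw [hSv, ← Rat.smul_def]
    exact Submodule.smul_mem _ _ hv
  · obtain ⟨v, hv, h⟩ := hasSum_odd hk hl hp
    obtain ⟨S, hS, hSv⟩ := exists_real_hasSum (f := fun n : ℕ => aperyB n *
        (zetaTrunc k n * tTrunc l n / (2 * (n : ℝ) + 1) ^ p)) (v := Complex.I * v)
      (by
        refine (hasSum_congr fun n => ?_).2 h
        simp only [zt]
        push_cast
        ring)
    exact ⟨S, hS, v, hv, hSv⟩
  · obtain ⟨v, hv, h⟩ := hasSum_odd_sq hk hl hq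
    obtain ⟨S, hS, hSv⟩ := exists_real_hasSum (f := fun n : ℕ => aperyB n ^ 2 *
        (zetaTrunc k n * tTrunc l n / (2 * (n : ℝ) + 1) ^ q)) (v := v)
      (by
        refine (hasSum_congr fun n => ?_).2 h
        simp only [zt]
        push_cast
        ring)
    exact ⟨S, hS, hSv ▸ hv⟩
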